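/- Fix $\alpha>0$. For each integer $N\ge 1$ let $M=\lfloor N^{1+\alpha}\rfloor$ and consider a continuous-time Markov process $(\eta(1,t),\dots,\eta(N,t),n_-(t),n_+(t))_{t\ge 0}$ on $\{0,1\}^{N}\times\{0,\dots,M\}\times\{0,\dots,M\}$ with the following dynamics: for each $1\le x\le N-1$ the values $\eta(x)$ and $\eta(x+1)$ are exchanged at rate $\tfrac12$; at rate $\tfrac12(1-\tfrac{n_+}{M})\eta(N)+\tfrac12\tfrac{n_+}{M}(1-\eta(N))$ the site $N$ exchanges a particle with the right reservoir, that is, if $\eta(N)=1$ then $\eta(N)$ becomes $0$ and $n_+$ becomes $n_++1$, and if $\eta(N)=0$ then $\eta(N)$ becomes $1$ and $n_+$ becomes $n_+-1$; and in the same way the site $1$ exchanges particles with the left reservoir, with $n_-$ and $\eta(1)$ in place of $n_+$ and $\eta(N)$. Put $\rho^N(x,t)=\mathbf E[\eta(x,t)]$ for $0\le x\le N+1$, where $\eta(0,t):=n_-(t)/M$ and $\eta(N+1,t):=n_+(t)/M$, and write $\rho^N_-(t)=\rho^N(0,t)$, $\rho^N_+(t)=\rho^N(N+1,t)$. Let $u_0$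 be continuous on $(0,1)$ with values in $[0,1]$, with some value assigned at the point $1$, and let $v_{0,\pm}\in[0,1]$. Suppose that at time $0$, $n_\pm(0)/M\to v_{0,\pm}$ in probability as $N\to\infty$, and $\rho^N(x,0)=u_0(x/N)$ for all $N\ge 1$ and $1\le x\le N$. Then: a) The problem $$u_t=\tfrac12 u_{rr}\ \text{ on } [0,1]\times(0,\infty),\qquad u(0,t)=v_{0,-},\quad u(1,t)=v_{0,+}\ \ (t>0),\qquad \lim_{t\downarrow 0}u(r,t)=u_0(r)\ \ (0<r<1)$$ has exactly one bounded classical solution $u$ (that is, $u$, $u_t$ and $u_{rr}$ exist and are continuous on $[0,1]\times(0,\infty)$, with one-sided $r$-derivatives at $r=0,1$), and for all $r\in[0,1]$ and $t>0$, as $N\to\infty$, $$\rho^N(\lfloor Nr\rfloor,N^2t)\to u(r,t),\qquad \rho^N_\pm(N^2t)\to v_{0,\pm}.$$ b) For all $\alpha'\in(0,\alpha)$, $r\in[0,1]$ and $t>0$, as $N\to\infty$, $$\rho^N(\lfloor Nr\rfloor,N^{2+\alpha'}t)\to (v_{0,+}-v_{0,-})\,r+v_{0,-},\qquad \rho^N_\pm(N^{2+\alpha'}t)\to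 v_{0,\pm}.$$ -/

import Mathlib

open MeasureTheory Filter Topology
open scoped NNReal

noncomputable section

namespace Channel

/-! ### Continuous-time Markov processes on a finite state space -/

/-- The semigroup `exp (t L)` on functions generated by a linear operator `L`. -/
def semigroup {S : Type*} [Fintype S] (L : (S → ℝ) →ₗ[ℝ] (S → ℝ)) (t : ℝ≥0) :
    (S → ℝ) →L[ℝ] (S → ℝ) :=
  NormedSpace.exp ((t : ℝ) • LinearMap.toContinuousLinearMap L)

/-- `X` is, under `P`, a Markov process (with respect to its own past) with generator `L`:
`E[f(X_{s+t}) | X_u, u ≤ s] = (exp (t L) f)(X_s)` almost surely. The initial law is free. -/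
structure IsMarkovProcess {S : Type*} [Fintype S] [MeasurableSpace S]
    (L : (S → ℝ) →ₗ[ℝ] (S → ℝ)) {Ω : Type*} [MeasurableSpace Ω] (P : Measure Ω)
    (X : ℝ≥0 → Ω → S) : Prop where
  measurable : ∀ t, Measurable (X t)
  markov : ∀ (s t : ℝ≥0) (f : S → ℝ),
    P[fun ω => f (X (s + t) ω) | ⨆ u : Set.Iic s, MeasurableSpace.comap (X u) inferInstance]
      =ᵐ[P] fun ω => semigroup L t f (X s ω)

/-! ### The particle system: a channel of `N` sites and two reservoirs of size `M` -/

/-- States `(η, n₋, n₊)`. The index `i : Fin N` is the site `i + 1` of the channel `{1, …, N}`. -/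
abbrev State (N M : ℕ) : Type := (Fin N → Bool) × Fin (M + 1) × Fin (M + 1)

/-- The number of particles, `0` or `1`, as a real number. -/
def occ (b : Bool) : ℝ := if b then 1 else 0

/-- The rate at which a boundary site with occupation `b` exchanges a particle with a reservoir
of size `M` holding `n` particles. -/
def boundaryRate {M : ℕ} (n : Fin (M + 1)) (b : Bool) : ℝ :=
  1 / 2 * (1 - (n : ℝ) / M) * occ b + 1 / 2 * ((n : ℝ) / M) * (1 - occ b)

/-- New number of particles in a reservoir after an exchange with a site with occupation `b`:
`n + 1` if the site gives its particle (`b = 1`), `n - 1` if it receives one (`b = 0`).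
The truncations at `M` and at `0` only matter where `boundaryRate` vanishes. -/
def reservoirUpdate {M : ℕ} (n : Fin (M + 1)) (b : Bool) : Fin (M + 1) :=
  if b then ⟨min (n + 1) M, by omega⟩ else ⟨n - 1, by omega⟩

/-- Exchange of the occupations of two channel sites. -/
def exchange {N M : ℕ} (i j : Fin N) (w : State N M) : State N M :=
  (w.1 ∘ Equiv.swap i j, w.2)

/-- Exchange of a particle between the site `i` and the left reservoir. -/
def flipLeft {N M : ℕ} (i : Fin N) (w : State N M) : State N M :=
  (Function.update w.1 i (!w.1 i), reservoirUpdate w.2.1 (w.1 i), w.2.2)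

/-- Exchange of a particle between the site `i` and the right reservoir. -/
def flipRight {N M : ℕ} (i : Fin N) (w : State N M) : State N M :=
  (Function.update w.1 i (!w.1 i), w.2.1, reservoirUpdate w.2.2 (w.1 i))

/-- The generator of the process: stirring at rate `1/2` over each bond of the channel, and
exchange of the first (last) site with the left (right) reservoir. -/
def generator (N M : ℕ) : (State N M → ℝ) →ₗ[ℝ] (State N M → ℝ) where
  toFun f w :=
    1 / 2 * (∑ i : Fin N, ∑ j : Fin N,
        if (i : ℕ) + 1 = j then f (exchange i j w) - f w else 0)
      + (∑ i : Fin N, if (i : ℕ) + 1 = N then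
          boundaryRate w.2.2 (w.1 i) * (f (flipRight i w) - f w) else 0)
      + (∑ i : Fin N, if (i : ℕ) = 0 then
          boundaryRate w.2.1 (w.1 i) * (f (flipLeft i w) - f w) else 0)
  map_add' f g := by
    funext w
    have h : ∀ (p : Prop) [Decidable p] (c a b a' b' : ℝ),
        (if p then c * (a + b - (a' + b')) else 0)
          = (if p then c * (a - a') else 0) + (if p then c * (b - b') else 0) := by
      intro p _ c a b a' b'
      split_ifs <;> ring
    have h₁ : ∀ (p : Prop) [Decidable p] (a b a' b' : ℝ),
        (if p then a + b - (a' + b') else 0)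
          = (if p then a - a' else 0) + (if p then b - b' else 0) := by
      intro p _ a b a' b'
      split_ifs <;> ring
    simp only [Pi.add_apply, h, h₁, Finset.sum_add_distrib]
    ring
  map_smul' c f := by
    funext w
    simp only [Pi.smul_apply, smul_eq_mul, RingHom.id_apply, mul_add, Finset.mul_sum]
    congr 1
    · congr 1
      · refine Finset.sum_congr rfl fun i _ => Finset.sum_congr rfl fun j _ => ?_
        split_ifs <;> ring
      · refine Finset.sum_congr rfl fun i _ => ?_
        split_ifs <;> ring
    · refine Finset.sum_congr rfl fun i _ => ?_
      split_ifs <;> ring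

/-- The value `η(x)`, `0 ≤ x ≤ N + 1`, with `η(0) = n₋ / M` and `η(N + 1) = n₊ / M`. -/
def eta {N M : ℕ} (w : State N M) (x : ℕ) : ℝ :=
  if x = 0 then (w.2.1 : ℝ) / M
  else if h : x - 1 < N then occ (w.1 ⟨x - 1, h⟩)
  else (w.2.2 : ℝ) / M

/-- The density `ρ(x, t) = E[η(x, t)]`, `0 ≤ x ≤ N + 1`. -/
def rho {N M : ℕ} {Ω : Type*} [MeasurableSpace Ω] (P : Measure Ω)
    (X : ℝ≥0 → Ω → State N M) (x : ℕ) (t : ℝ≥0) : ℝ :=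
  ∫ ω, eta (X t ω) x ∂P

/-- The size of each reservoir, `N ^ (1 + α)` (its integer part). -/
def reservoirSize (α : ℝ) (N : ℕ) : ℕ := ⌊(N : ℝ) ^ (1 + α)⌋₊

/-! ### The limit equation -/

/-- `u` is a bounded classical solution of `u_t = u_rr / 2` on `[0,1] × (0,∞)` with boundary values
`vMinus` at `r = 0` and `vPlus` at `r = 1`, and `u(r,t) → u₀(r)` as `t ↓ 0` for `0 < r < 1`. -/
structure IsHeatSolution (u₀ : ℝ → ℝ) (vMinus vPlus : ℝ) (u : ℝ → ℝ → ℝ) : Prop where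
  bounded : ∃ C : ℝ, ∀ r ∈ Set.Icc (0 : ℝ) 1, ∀ t > 0, |u r t| ≤ C
  continuousOn : ContinuousOn (Function.uncurry u) (Set.Icc 0 1 ×ˢ Set.Ioi 0)
  equation : ∃ ur urr : ℝ → ℝ → ℝ,
    ContinuousOn (Function.uncurry urr) (Set.Icc 0 1 ×ˢ Set.Ioi 0) ∧
    ∀ r ∈ Set.Icc (0 : ℝ) 1, ∀ t > 0,
      HasDerivWithinAt (fun x => u x t) (ur r t) (Set.Icc 0 1) r ∧
      HasDerivWithinAt (fun x => ur x t) (urr r t) (Set.Icc 0 1) r ∧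
      HasDerivAt (fun s => u r s) (1 / 2 * urr r t) t
  left_boundary : ∀ t > 0, u 0 t = vMinus
  right_boundary : ∀ t > 0, u 1 t = vPlus
  initial : ∀ r ∈ Set.Ioo (0 : ℝ) 1, Tendsto (fun t => u r t) (𝓝[>] 0) (𝓝 (u₀ r))

end Channel

end

/-!
The occupation variables satisfy a closed linear system: under the generator, `η(x)` evolves by the
discrete Laplacian inside the channel, and `n_± / M` by the boundary currents divided by `M`. Hence
the densities solve a deterministic discrete heat equation coupled to two slowly varying reservoirs.

The total first moment of the particles changes at rate at most `1 / 2` and gives the weight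
`(N + 1) M` to the right reservoir, so up to time `s` the reservoir densities move by at most
`(N + s / (2 (N + 1))) / M`. The maximum principle then compares the densities with the solution of
the discrete heat equation whose boundary values are frozen at `v_±`.

That solution is the linear profile plus an explicit sum of decaying discrete sine modes. On the
diffusive scale `N² t` it converges term by term, by dominated convergence, to the Fourier series of
the heat equation; on longer scales every mode dies and the linear profile remains. Uniqueness for
the heat equation follows from the decay of the energy of the difference of two solutions, which
starts from `0` because bounded solutions converge in `L²` as `t ↓ 0`.
-/

namespace Channel

/-! ### The discrete heat equation -/

/-- `g` solves the discrete heat equation `∂ₜ g = ½ Δ g` at the sites `1, …, N`. -/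
def IsDiscreteHeat (N : ℕ) (g : ℕ → ℝ → ℝ) : Prop :=
  ∀ x < N, ∀ t, HasDerivAt (g (x + 1)) (1 / 2 * (g (x + 2) t + g x t - 2 * g (x + 1) t)) t

theorem deriv_nonneg_of_isMaxOn_Icc {h : ℝ → ℝ} {d s T : ℝ} (hs : 0 < s) (hsT : s ≤ T)
    (hd : HasDerivAt h d s) (hmax : IsMaxOn h (Set.Icc 0 T) s) : 0 ≤ d := by
  have hseg : segment ℝ s 0 ⊆ Set.Icc 0 T := by
    rw [segment_symm, segment_eq_Icc hs.le]
    exact Set.Icc_subset_Icc_right hsT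
  have hle := (hmax.localize).hasFDerivWithinAt_nonpos hd.hasFDerivAt.hasFDerivWithinAt
    (sub_mem_posTangentConeAt_of_segment_subset hseg)
  simp only [zero_sub, ContinuousLinearMap.toSpanSingleton_apply, smul_eq_mul] at hle
  nlinarith

theorem nonpos_of_deriv_lt_laplacian {N : ℕ} {T : ℝ} {g g' : ℕ → ℝ → ℝ}
    (hg : ∀ x < N, ∀ t, HasDerivAt (g (x + 1)) (g' x t) t)
    (hlt : ∀ x < N, ∀ t ∈ Set.Icc 0 T,
      g' x t < 1 / 2 * (g (x + 2) t + g x t - 2 * g (x + 1) t))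
    (hinit : ∀ x < N, g (x + 1) 0 ≤ 0)
    (hleft : ∀ t ∈ Set.Icc 0 T, g 0 t ≤ 0) (hright : ∀ t ∈ Set.Icc 0 T, g (N + 1) t ≤ 0) :
    ∀ x < N, ∀ t ∈ Set.Icc 0 T, g (x + 1) t ≤ 0 := by
  by_contra! ⟨x₀, hx₀, t₀, ht₀, hpos⟩
  have hcont : ContinuousOn (fun p : Fin N × ℝ => g (p.1 + 1) p.2) (Set.univ ×ˢ Set.Icc 0 T) :=
    continuousOn_prod_of_discrete_left.2 fun x t _ =>
      (hg x x.2 t).continuousAt.continuousWithinAt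
  obtain ⟨⟨⟨x, hx⟩, s⟩, ⟨-, hs⟩, hmax⟩ := (isCompact_univ.prod isCompact_Icc).exists_isMaxOn
    ⟨(⟨x₀, hx₀⟩, t₀), Set.mem_univ _, ht₀⟩ hcont
  have hle : ∀ y < N, ∀ t ∈ Set.Icc 0 T, g (y + 1) t ≤ g (x + 1) s := fun y hy t ht =>
    hmax (a := (⟨y, hy⟩, t)) ⟨Set.mem_univ _, ht⟩
  have hval : 0 < g (x + 1) s := hpos.trans_le (hle x₀ hx₀ t₀ ht₀)
  have hs₀ : 0 < s := hs.1.lt_of_ne fun h => (hinit x hx).not_gt (h ▸ hval)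
  have hup : g (x + 2) s ≤ g (x + 1) s := by
    by_cases h : x + 1 < N
    · exact hle (x + 1) h s hs
    · obtain rfl : N = x + 1 := by omega
      exact (hright s hs).trans hval.le
  have hdown : g x s ≤ g (x + 1) s := by
    rcases x with _ | x
    · exact (hleft s hs).trans hval.le
    · exact hle x (by omega) s hs
  have hderiv := deriv_nonneg_of_isMaxOn_Icc hs₀ hs.2 (hg x hx s) (hle x hx)
  linarith [hlt x hx s hs]

namespace IsDiscreteHeat

variable {N : ℕ} {f g B : ℕ → ℝ → ℝ}

theorem add (hf : IsDiscreteHeat N f) (hg : IsDiscreteHeat N g) :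
    IsDiscreteHeat N (fun x t => f x t + g x t) := fun x hx t =>
  ((hf x hx t).fun_add (hg x hx t)).congr_deriv (by ring)

theorem sub (hf : IsDiscreteHeat N f) (hg : IsDiscreteHeat N g) :
    IsDiscreteHeat N (fun x t => f x t - g x t) := fun x hx t =>
  ((hf x hx t).fun_sub (hg x hx t)).congr_deriv (by ring)

theorem sum {ι : Type*} {s : Finset ι} {f : ι → ℕ → ℝ → ℝ}
    (hf : ∀ i ∈ s, IsDiscreteHeat N (f i)) :
    IsDiscreteHeat N (fun x t => ∑ i ∈ s, f i x t) := fun x hx t => by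
  refine (HasDerivAt.fun_sum fun i hi => hf i hi x hx t).congr_deriv ?_
  rw [← Finset.mul_sum, Finset.sum_sub_distrib, Finset.sum_add_distrib, Finset.mul_sum]

theorem affine (N : ℕ) (a b : ℝ) : IsDiscreteHeat N (fun x _ => a * x + b) := fun x _ t =>
  (hasDerivAt_const t _).congr_deriv (by push_cast; ring)

theorem quadratic (N : ℕ) (ε K h r : ℝ) :
    IsDiscreteHeat N (fun x t => ε + K * ((x / h - r) ^ 2 + t / h ^ 2)) := fun x _ t =>
  (((((hasDerivAt_id t).div_const (h ^ 2)).const_add _).const_mul K).const_add ε).congr_deriv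
    (by push_cast; ring)

/-- An arbitrarily small multiple of `t` makes the inequality between `∂ₜ g` and `½ Δ g` strict. -/
theorem nonpos (hg : IsDiscreteHeat N g) {T : ℝ} (hinit : ∀ x < N, g (x + 1) 0 ≤ 0)
    (hleft : ∀ t ∈ Set.Icc 0 T, g 0 t ≤ 0) (hright : ∀ t ∈ Set.Icc 0 T, g (N + 1) t ≤ 0)
    {x : ℕ} (hx : x ≤ N + 1) {t : ℝ} (ht : t ∈ Set.Icc 0 T) : g x t ≤ 0 := by
  rcases x with _ | x
  · exact hleft t ht
  rcases (Nat.le_of_succ_le_succ hx).eq_or_lt with rfl | hxN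
  · exact hright t ht
  have hperturbed : ∀ ε > 0, g (x + 1) t - ε * t ≤ 0 := fun ε hε =>
    nonpos_of_deriv_lt_laplacian (g := fun y s => g y s - ε * s)
      (fun y hy s => (hg y hy s).fun_sub ((hasDerivAt_id s).const_mul ε))
      (fun y _ s _ => by linarith) (fun y hy => by simpa using hinit y hy)
      (fun s hs => sub_nonpos.2 ((hleft s hs).trans (mul_nonneg hε.le hs.1)))
      (fun s hs => sub_nonpos.2 ((hright s hs).trans (mul_nonneg hε.le hs.1))) x hxN t ht
  have ht₁ : 0 < t + 1 := by linarith [ht.1]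
  refine le_of_forall_pos_le_add fun ε hε => ?_
  have hscaled := hperturbed (ε / (t + 1)) (by positivity)
  have hfrac : ε / (t + 1) * t ≤ ε := by
    rw [div_mul_eq_mul_div, div_le_iff₀ ht₁]
    nlinarith
  linarith

theorem le (hf : IsDiscreteHeat N f) (hg : IsDiscreteHeat N g) {T : ℝ}
    (hinit : ∀ x < N, f (x + 1) 0 ≤ g (x + 1) 0)
    (hleft : ∀ t ∈ Set.Icc 0 T, f 0 t ≤ g 0 t)
    (hright : ∀ t ∈ Set.Icc 0 T, f (N + 1) t ≤ g (N + 1) t)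
    {x : ℕ} (hx : x ≤ N + 1) {t : ℝ} (ht : t ∈ Set.Icc 0 T) : f x t ≤ g x t :=
  sub_nonpos.1 <| (hf.sub hg).nonpos (fun y hy => sub_nonpos.2 (hinit y hy))
    (fun s hs => sub_nonpos.2 (hleft s hs)) (fun s hs => sub_nonpos.2 (hright s hs)) hx ht

theorem abs_sub_le (hf : IsDiscreteHeat N f) (hg : IsDiscreteHeat N g) (hB : IsDiscreteHeat N B)
    {T : ℝ} (hinit : ∀ x < N, |f (x + 1) 0 - g (x + 1) 0| ≤ B (x + 1) 0)
    (hleft : ∀ t ∈ Set.Icc 0 T, |f 0 t - g 0 t| ≤ B 0 t)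
    (hright : ∀ t ∈ Set.Icc 0 T, |f (N + 1) t - g (N + 1) t| ≤ B (N + 1) t)
    {x : ℕ} (hx : x ≤ N + 1) {t : ℝ} (ht : t ∈ Set.Icc 0 T) : |f x t - g x t| ≤ B x t :=
  abs_le'.2 ⟨(hf.sub hg).le hB (fun y hy => (abs_le'.1 (hinit y hy)).1)
      (fun s hs => (abs_le'.1 (hleft s hs)).1) (fun s hs => (abs_le'.1 (hright s hs)).1) hx ht, by
    simpa only [neg_sub] using (hg.sub hf).le hB
      (fun y hy => by simpa only [neg_sub] using (abs_le'.1 (hinit y hy)).2)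
      (fun s hs => by simpa only [neg_sub] using (abs_le'.1 (hleft s hs)).2)
      (fun s hs => by simpa only [neg_sub] using (abs_le'.1 (hright s hs)).2) hx ht⟩

end IsDiscreteHeat

/-! ### The discrete sine series -/

theorem sum_cos_int_mul_pi_div {N : ℕ} {m : ℤ} (hm : m ≠ 0) (hmN : |m| < 2 * (N + 1)) :
    ∑ k ∈ Finset.range N, Real.cos ((k + 1) * (m * Real.pi / (N + 1)))
      = -(Real.cos (m * Real.pi) + 1) / 2 := by
  have hN : (0 : ℝ) < N + 1 := by positivity
  have hm' : (m : ℝ) ≠ 0 := by exact_mod_cast hm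
  have hmN' : |(m : ℝ)| < 2 * (N + 1) := by exact_mod_cast hmN
  set θ : ℝ := m * Real.pi / (N + 1) with hθ
  have hhalf : |θ / 2| < Real.pi := by
    rw [hθ, abs_div, abs_div, abs_mul, abs_of_pos Real.pi_pos, abs_of_pos hN,
      abs_of_pos (two_pos (α := ℝ)), div_div, div_lt_iff₀ (by positivity)]
    nlinarith [Real.pi_pos]
  have hsin : Real.sin (θ / 2) ≠ 0 := by
    rw [Ne, Real.sin_eq_zero_iff_of_lt_of_lt (abs_lt.1 hhalf).1 (abs_lt.1 hhalf).2]
    have := Real.pi_ne_zero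
    positivity
  have hprod : 2 * (Real.sin (N * θ / 2) * Real.cos ((N - 1) * θ / 2 + θ))
      = -Real.sin (θ / 2) * (Real.cos (m * Real.pi) + 1) := by
    have hdiff : N * θ / 2 - ((N - 1) * θ / 2 + θ) = -(θ / 2) := by ring
    have hsum : N * θ / 2 + ((N - 1) * θ / 2 + θ) = m * Real.pi - θ / 2 := by
      rw [hθ]
      field_simp
      ring
    rw [← mul_assoc, Real.two_mul_sin_mul_cos, hdiff, hsum, Real.sin_sub, Real.sin_int_mul_pi,
      Real.sin_neg]
    ring
  have hclosed := Real.sin_mul_sum_cos N θ θ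
  refine mul_left_cancel₀ hsin ?_
  calc Real.sin (θ / 2) * ∑ k ∈ Finset.range N, Real.cos ((k + 1) * θ)
      = Real.sin (θ / 2) * ∑ k ∈ Finset.range N, Real.cos (θ * k + θ) := by
        congr! 3
        ring
    _ = Real.sin (θ / 2) * (-(Real.cos (m * Real.pi) + 1) / 2) := by linarith

theorem sum_sin_mul_sin {N x y : ℕ} (hx : x < N) (hy : y < N) :
    ∑ k ∈ Finset.range N, Real.sin ((k + 1) * Real.pi * ((y + 1 : ℕ) / (N + 1))) *
      Real.sin ((k + 1) * Real.pi * ((x + 1 : ℕ) / (N + 1)))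
      = if x = y then ((N : ℝ) + 1) / 2 else 0 := by
  set m : ℤ := y - x with hm
  set p : ℤ := y + x + 2 with hp
  have hprod : ∀ k : ℕ, Real.sin ((k + 1) * Real.pi * ((y + 1 : ℕ) / (N + 1))) *
      Real.sin ((k + 1) * Real.pi * ((x + 1 : ℕ) / (N + 1)))
      = 1 / 2 * (Real.cos ((k + 1) * (m * Real.pi / (N + 1)))
        - Real.cos ((k + 1) * (p * Real.pi / (N + 1)))) := fun k => by
    rw [← mul_right_inj' two_ne_zero, ← mul_assoc, Real.two_mul_sin_mul_sin, ← mul_assoc,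
      mul_one_div_cancel two_ne_zero, one_mul]
    congr 2 <;> push_cast [hm, hp] <;> ring
  have hcos : Real.cos (p * Real.pi) = Real.cos (m * Real.pi) := by
    rw [← Real.cos_add_nat_mul_two_pi (m * Real.pi) (x + 1)]
    congr 1
    push_cast [hm, hp]
    ring
  simp only [hprod, ← Finset.mul_sum, Finset.sum_sub_distrib]
  rw [sum_cos_int_mul_pi_div (m := p) (by omega) (by rw [abs_lt]; omega), hcos]
  split_ifs with hxy
  · have hm₀ : (m : ℝ) = 0 := by simp [hm, hxy]
    simp only [hm₀, zero_mul, zero_div, mul_zero, Real.cos_zero, Finset.sum_const,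
      Finset.card_range, nsmul_eq_mul, mul_one]
    ring
  · rw [sum_cos_int_mul_pi_div (m := m) (by omega) (by rw [abs_lt]; omega)]
    ring

/-- The `(k + 1)`-st discrete sine coefficient of the values `d 1, …, d N`. -/
noncomputable def sineCoeff (N : ℕ) (d : ℕ → ℝ) (k : ℕ) : ℝ :=
  2 / (N + 1) * ∑ y ∈ Finset.range N,
    d (y + 1) * Real.sin ((k + 1) * Real.pi * ((y + 1 : ℕ) / (N + 1)))

/-- The `(k + 1)`-st mode of the solution of the discrete heat equation with initial values `d` and
zero boundary values at `0` and `N + 1`. -/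
noncomputable def sineMode (N : ℕ) (d : ℕ → ℝ) (k x : ℕ) (t : ℝ) : ℝ :=
  sineCoeff N d k * Real.exp (-((1 - Real.cos ((k + 1) * Real.pi / (N + 1))) * t)) *
    Real.sin ((k + 1) * Real.pi * (x / (N + 1)))

theorem sum_sineMode_zero {N : ℕ} (d : ℕ → ℝ) {x : ℕ} (hx : x < N) :
    ∑ k ∈ Finset.range N, sineMode N d k (x + 1) 0 = d (x + 1) := by
  have hN : (N : ℝ) + 1 ≠ 0 := by positivity
  have horth : ∀ y ∈ Finset.range N, ∑ k ∈ Finset.range N,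
      d (y + 1) * Real.sin ((k + 1) * Real.pi * ((y + 1 : ℕ) / (N + 1))) *
        Real.sin ((k + 1) * Real.pi * ((x + 1 : ℕ) / (N + 1)))
      = if x = y then d (y + 1) * (((N : ℝ) + 1) / 2) else 0 := fun y hy => by
    simp only [mul_assoc (d (y + 1)), ← Finset.mul_sum]
    rw [sum_sin_mul_sin hx (Finset.mem_range.1 hy), mul_ite, mul_zero]
  simp only [sineMode, sineCoeff, mul_zero, neg_zero, Real.exp_zero, mul_one,
    mul_assoc (2 / ((N : ℝ) + 1)), Finset.sum_mul]
  rw [← Finset.mul_sum, Finset.sum_comm, Finset.sum_congr rfl horth, Finset.sum_ite_eq,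
    if_pos (Finset.mem_range.2 hx)]
  field_simp

theorem isDiscreteHeat_sineMode (N : ℕ) (d : ℕ → ℝ) (k : ℕ) :
    IsDiscreteHeat N (sineMode N d k) := fun x _ t => by
  set θ : ℝ := (k + 1) * Real.pi / (N + 1) with hθ
  have hderiv := (((((hasDerivAt_id t).const_mul (1 - Real.cos θ)).fun_neg.exp).const_mul
    (sineCoeff N d k)).mul_const (Real.sin ((k + 1) * Real.pi * ((x + 1 : ℕ) / (N + 1)))))
  have hsucc : ((k : ℝ) + 1) * Real.pi * ((x + 2 : ℕ) / (N + 1))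
      = (k + 1) * Real.pi * ((x + 1 : ℕ) / (N + 1)) + θ := by
    rw [hθ]
    push_cast
    ring
  have hpred : ((k : ℝ) + 1) * Real.pi * ((x : ℝ) / (N + 1))
      = (k + 1) * Real.pi * ((x + 1 : ℕ) / (N + 1)) - θ := by
    rw [hθ]
    push_cast
    ring
  refine hderiv.congr_deriv ?_
  simp only [sineMode, hsucc, hpred, Real.sin_add, Real.sin_sub, id, ← hθ]
  ring

theorem sineMode_left (N : ℕ) (d : ℕ → ℝ) (k : ℕ) (t : ℝ) : sineMode N d k 0 t = 0 := by
  simp [sineMode]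

theorem sineMode_right (N : ℕ) (d : ℕ → ℝ) (k : ℕ) (t : ℝ) : sineMode N d k (N + 1) t = 0 := by
  have hN : (N : ℝ) + 1 ≠ 0 := by positivity
  have hnode : ((k : ℝ) + 1) * Real.pi * (((N + 1 : ℕ) : ℝ) / (N + 1))
      = ((k + 1 : ℕ) : ℝ) * Real.pi := by
    push_cast
    field_simp
  rw [sineMode, hnode, Real.sin_nat_mul_pi, mul_zero]

theorem abs_sineCoeff_le {N : ℕ} {d : ℕ → ℝ} {C : ℝ} (hC : 0 ≤ C)
    (hd : ∀ y < N, |d (y + 1)| ≤ C) (k : ℕ) : |sineCoeff N d k| ≤ 2 * C := by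
  have hsum : |∑ y ∈ Finset.range N,
      d (y + 1) * Real.sin ((k + 1) * Real.pi * ((y + 1 : ℕ) / (N + 1)))| ≤ (N + 1) * C :=
    calc _ ≤ ∑ y ∈ Finset.range N,
          |d (y + 1) * Real.sin ((k + 1) * Real.pi * ((y + 1 : ℕ) / (N + 1)))| :=
          Finset.abs_sum_le_sum_abs _ _
      _ ≤ ∑ _y ∈ Finset.range N, C := Finset.sum_le_sum fun y hy => by
          rw [abs_mul]
          exact mul_le_of_le_one_right (abs_nonneg _) (Real.abs_sin_le_one _) |>.trans
            (hd y (Finset.mem_range.1 hy))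
      _ ≤ (N + 1) * C := by
          rw [Finset.sum_const, Finset.card_range, nsmul_eq_mul]
          linarith
  calc |sineCoeff N d k| ≤ 2 / ((N : ℝ) + 1) * ((N + 1) * C) := by
        rw [sineCoeff, abs_mul, abs_of_pos (by positivity : (0 : ℝ) < 2 / (N + 1))]
        gcongr
    _ = 2 * C := by field_simp

theorem mul_sq_le_one_sub_cos {N k : ℕ} (hk : k < N) :
    2 * ((k : ℝ) + 1) ^ 2 / (N + 1) ^ 2 ≤ 1 - Real.cos ((k + 1) * Real.pi / (N + 1)) := by
  have hN : (0 : ℝ) < N + 1 := by positivity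
  have hk' : (k : ℝ) + 1 ≤ N := by exact_mod_cast hk
  have hpi := Real.pi_pos
  have hcos := Real.cos_le_one_sub_mul_cos_sq (x := (k + 1) * Real.pi / (N + 1)) (by
    rw [abs_of_nonneg (by positivity), div_le_iff₀ hN]
    nlinarith)
  have hsq : 2 / Real.pi ^ 2 * ((k + 1) * Real.pi / (N + 1)) ^ 2
      = 2 * ((k : ℝ) + 1) ^ 2 / (N + 1) ^ 2 := by field_simp
  linarith

theorem abs_sineMode_le {N : ℕ} {d : ℕ → ℝ} {C : ℝ} (hd : ∀ y < N, |d (y + 1)| ≤ C)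
    {k : ℕ} (hk : k < N) (x : ℕ) {q s : ℝ} (hs : 0 ≤ s) (hq : q * (N + 1) ^ 2 ≤ 2 * s) :
    |sineMode N d k x s| ≤ 2 * C * Real.exp (-((k + 1) * q)) := by
  have hC : 0 ≤ C := (abs_nonneg _).trans (hd k hk)
  have hrate : ((k : ℝ) + 1) * q ≤ (1 - Real.cos ((k + 1) * Real.pi / (N + 1))) * s :=
    calc ((k : ℝ) + 1) * q ≤ (k + 1) * (2 * s / (N + 1) ^ 2) := by
          gcongr
          rwa [le_div_iff₀ (by positivity)]
      _ ≤ ((k : ℝ) + 1) ^ 2 * (2 * s / (N + 1) ^ 2) := by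
          gcongr
          exact le_self_pow₀ (by simp) two_ne_zero
      _ = 2 * ((k : ℝ) + 1) ^ 2 / (N + 1) ^ 2 * s := by ring
      _ ≤ _ := by
          gcongr
          exact mul_sq_le_one_sub_cos hk
  rw [sineMode, abs_mul, abs_mul, Real.abs_exp]
  calc _ ≤ 2 * C * Real.exp (-((k + 1) * q)) * 1 := by
        gcongr
        · exact abs_sineCoeff_le hC hd k
        · exact Real.abs_sin_le_one _
    _ = _ := mul_one _

/-! ### The discrete Dirichlet problem -/

/-- The affine function with value `a` at `0` and `b` at `1`: the stationary state of the heat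
equation with these boundary values. -/
def stationaryProfile (a b z : ℝ) : ℝ := (b - a) * z + a

theorem stationaryProfile_zero (a b : ℝ) : stationaryProfile a b 0 = a := by
  simp [stationaryProfile]

theorem stationaryProfile_one (a b : ℝ) : stationaryProfile a b 1 = b := by
  simp [stationaryProfile]

theorem abs_stationaryProfile_le (a b : ℝ) {z : ℝ} (hz : z ∈ Set.Icc (0 : ℝ) 1) :
    |stationaryProfile a b z| ≤ |a| + |b| := by
  have hconvex : stationaryProfile a b z = (1 - z) * a + z * b := by
    rw [stationaryProfile]
    ring
  rw [hconvex]
  refine (abs_add_le _ _).trans (add_le_add ?_ ?_)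
  · rw [abs_mul, abs_of_nonneg (sub_nonneg.2 hz.2)]
    exact mul_le_of_le_one_left (abs_nonneg a) (by linarith [hz.1])
  · rw [abs_mul, abs_of_nonneg hz.1]
    exact mul_le_of_le_one_left (abs_nonneg b) hz.2

/-- The deviation of the values `d` at the sites `x / (N + 1)` from the stationary profile. -/
noncomputable def deviation (N : ℕ) (a b : ℝ) (d : ℕ → ℝ) (x : ℕ) : ℝ :=
  d x - stationaryProfile a b (x / (N + 1))

theorem abs_deviation_le {N : ℕ} {d : ℕ → ℝ} {C : ℝ} (a b : ℝ) (hd : ∀ y < N, |d (y + 1)| ≤ C) :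
    ∀ y < N, |deviation N a b d (y + 1)| ≤ C + (|a| + |b|) := fun y hy => by
  have hy' : (y : ℝ) + 1 ≤ N := by exact_mod_cast hy
  refine (abs_sub _ _).trans (add_le_add (hd y hy) (abs_stationaryProfile_le a b ⟨?_, ?_⟩))
  · positivity
  · rw [div_le_one (by positivity)]
    push_cast
    linarith

/-- The solution of the discrete heat equation with initial values `d` and constant boundary
values `a` at `0` and `b` at `N + 1`. -/
noncomputable def dirichletSolution (N : ℕ) (a b : ℝ) (d : ℕ → ℝ) (x : ℕ) (t : ℝ) : ℝ :=
  stationaryProfile a b (x / (N + 1)) + ∑ k ∈ Finset.range N, sineMode N (deviation N a b d) k x t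

theorem isDiscreteHeat_dirichletSolution (N : ℕ) (a b : ℝ) (d : ℕ → ℝ) :
    IsDiscreteHeat N (dirichletSolution N a b d) := by
  have haffine := IsDiscreteHeat.affine N ((b - a) / (N + 1)) a
  have hmodes : IsDiscreteHeat N
      (fun x t => ∑ k ∈ Finset.range N, sineMode N (deviation N a b d) k x t) :=
    IsDiscreteHeat.sum fun k _ => isDiscreteHeat_sineMode N (deviation N a b d) k
  convert haffine.add hmodes using 3 with x t
  rw [dirichletSolution, stationaryProfile, mul_div_assoc', div_mul_eq_mul_div]

theorem dirichletSolution_left (N : ℕ) (a b : ℝ) (d : ℕ → ℝ) (t : ℝ) :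
    dirichletSolution N a b d 0 t = a := by
  simp [dirichletSolution, sineMode_left, stationaryProfile_zero]

theorem dirichletSolution_right (N : ℕ) (a b : ℝ) (d : ℕ → ℝ) (t : ℝ) :
    dirichletSolution N a b d (N + 1) t = b := by
  have hN : (N : ℝ) + 1 ≠ 0 := by positivity
  simp [dirichletSolution, sineMode_right, hN, stationaryProfile_one]

theorem dirichletSolution_initial {N : ℕ} (a b : ℝ) (d : ℕ → ℝ) {x : ℕ} (hx : x < N) :
    dirichletSolution N a b d (x + 1) 0 = d (x + 1) := by
  rw [dirichletSolution, sum_sineMode_zero _ hx, deviation, add_sub_cancel]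

/-! ### Scaling limits of the discrete Dirichlet problem -/

theorem integral_comp_floor (F : ℕ → ℝ) (n : ℕ) :
    ∫ z in (0 : ℝ)..n, F ⌊z⌋₊ = ∑ y ∈ Finset.range n, F y := by
  have hfloor : ∀ y : ℕ, ∀ z ∈ Set.uIoo (y : ℝ) (y + 1 : ℕ), F ⌊z⌋₊ = F y := fun y z hz => by
    rw [Set.uIoo_of_le (by push_cast; linarith)] at hz
    rw [(Nat.floor_eq_iff (y.cast_nonneg.trans hz.1.le)).2 ⟨hz.1.le, by exact_mod_cast hz.2⟩]
  have hpiece : ∀ y : ℕ, ∫ z in (y : ℝ)..(y + 1 : ℕ), F ⌊z⌋₊ = F y := fun y => by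
    rw [intervalIntegral.integral_congr_uIoo (hfloor y)]
    simp
  have hint : ∀ y < n, IntervalIntegrable (fun z : ℝ => F ⌊z⌋₊) volume (y : ℝ) (y + 1 : ℕ) :=
    fun y _ => (intervalIntegrable_const (c := F y)).congr_uIoo fun z hz => (hfloor y z hz).symm
  have hadd := intervalIntegral.sum_integral_adjacent_intervals (a := fun y : ℕ => (y : ℝ)) hint
  simpa only [hpiece, Nat.cast_zero] using hadd.symm

theorem floor_mul_lt {N : ℕ} (hN : 0 < N) {z : ℝ} (hz : z ∈ Set.Ioo (0 : ℝ) 1) :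
    ⌊(N : ℝ) * z⌋₊ < N :=
  (Nat.floor_lt (mul_nonneg N.cast_nonneg hz.1.le)).2
    (mul_lt_of_lt_one_right (by exact_mod_cast hN) hz.2)

theorem floor_mul_le (N : ℕ) {r : ℝ} (hr : r ≤ 1) : ⌊(N : ℝ) * r⌋₊ ≤ N :=
  Nat.floor_le_of_le (mul_le_of_le_one_right N.cast_nonneg hr)

theorem ae_mem_Ioo_of_mem_uIoc : ∀ᵐ z : ℝ, z ∈ Set.uIoc 0 1 → z ∈ Set.Ioo (0 : ℝ) 1 := by
  filter_upwards [Measure.ae_ne volume (1 : ℝ)] with z hz₁ hz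
  rw [Set.uIoc_of_le zero_le_one] at hz
  exact ⟨hz.1, hz.2.lt_of_ne hz₁⟩

theorem tendsto_riemann_sum {h : ℕ → ℕ → ℝ} {g : ℝ → ℝ} {C : ℝ}
    (hC : ∀ᶠ N in atTop, ∀ y < N, |h N y| ≤ C)
    (hlim : ∀ z ∈ Set.Ioo (0 : ℝ) 1, Tendsto (fun N : ℕ => h N ⌊(N : ℝ) * z⌋₊) atTop (𝓝 (g z))) :
    Tendsto (fun N : ℕ => (∑ y ∈ Finset.range N, h N y) / N) atTop
      (𝓝 (∫ z in (0 : ℝ)..1, g z)) := by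
  have hsum : ∀ᶠ N : ℕ in atTop, ∫ z in (0 : ℝ)..1, h N ⌊(N : ℝ) * z⌋₊
      = (∑ y ∈ Finset.range N, h N y) / N := by
    filter_upwards [eventually_ne_atTop 0] with N hN
    rw [intervalIntegral.integral_comp_mul_left (fun z => h N ⌊z⌋₊) (Nat.cast_ne_zero.2 hN),
      mul_zero, mul_one, integral_comp_floor, smul_eq_mul, inv_mul_eq_div]
  refine Tendsto.congr' hsum ?_
  refine intervalIntegral.tendsto_integral_filter_of_dominated_convergence (fun _ => C) ?_ ?_
    intervalIntegrable_const ?_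
  · exact Eventually.of_forall fun N => ((measurable_from_nat (f := h N)).comp
      (Nat.measurable_floor.comp (measurable_const_mul (N : ℝ)))).aestronglyMeasurable
  · filter_upwards [eventually_gt_atTop 0, hC] with N hN hCN
    filter_upwards [ae_mem_Ioo_of_mem_uIoc] with z hz hz'
    exact hCN _ (floor_mul_lt hN (hz hz'))
  · filter_upwards [ae_mem_Ioo_of_mem_uIoc] with z hz hz'
    exact hlim z (hz hz')

theorem tendsto_natCast_div_add_one : Tendsto (fun N : ℕ => (N : ℝ) / (N + 1)) atTop (𝓝 1) :=
  tendsto_natCast_div_add_atTop (1 : ℝ)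

theorem tendsto_floor_div {r : ℝ} (hr : 0 ≤ r) :
    Tendsto (fun N : ℕ => (⌊(N : ℝ) * r⌋₊ : ℝ) / N) atTop (𝓝 r) := by
  simpa only [Function.comp_def, mul_comm r] using
    (tendsto_nat_floor_mul_div_atTop (R := ℝ) hr).comp tendsto_natCast_atTop_atTop

theorem tendsto_floor_add_one_div {r : ℝ} (hr : 0 ≤ r) :
    Tendsto (fun N : ℕ => ((⌊(N : ℝ) * r⌋₊ + 1 : ℕ) : ℝ) / N) atTop (𝓝 r) := by
  simpa only [← add_div, add_zero, Nat.cast_add_one] using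
    (tendsto_floor_div hr).add tendsto_one_div_atTop_nhds_zero_nat

theorem tendsto_div_add_one_of_tendsto_div {x : ℕ → ℝ} {r : ℝ}
    (hx : Tendsto (fun N : ℕ => x N / N) atTop (𝓝 r)) :
    Tendsto (fun N : ℕ => x N / (N + 1)) atTop (𝓝 r) := by
  have hmul := hx.mul tendsto_natCast_div_add_one
  rw [mul_one] at hmul
  refine hmul.congr' ?_
  filter_upwards [eventually_ne_atTop 0] with N hN
  have hN' : (N : ℝ) ≠ 0 := Nat.cast_ne_zero.2 hN
  field_simp

theorem tendsto_one_sub_cos_mul_sq (a : ℝ) :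
    Tendsto (fun N : ℕ => (1 - Real.cos (a / (N + 1))) * (N : ℝ) ^ 2) atTop (𝓝 (a ^ 2 / 2)) := by
  have hzero : Tendsto (fun N : ℕ => a / 2 / ((N : ℝ) + 1)) atTop (𝓝 0) :=
    tendsto_const_nhds.div_atTop (tendsto_atTop_add_const_right _ _ tendsto_natCast_atTop_atTop)
  have hsinc : Tendsto (fun N : ℕ => Real.sinc (a / 2 / (N + 1))) atTop (𝓝 1) := by
    simpa only [Real.sinc_zero, Function.comp_def] using (Real.continuous_sinc.tendsto 0).comp hzero
  have hlim := (((tendsto_natCast_div_add_one.const_mul (a / 2)).mul hsinc).pow 2).const_mul 2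
  rw [show 2 * (a / 2 * 1 * 1) ^ 2 = a ^ 2 / 2 by ring] at hlim
  refine hlim.congr fun N => ?_
  set y : ℝ := a / 2 / (N + 1) with hy
  have hsin : Real.sin y = y * Real.sinc y := by
    rcases eq_or_ne y 0 with h | h
    · simp [h]
    · rw [Real.sinc_of_ne_zero h, mul_div_cancel₀ _ h]
  have hcos : 1 - Real.cos (a / (N + 1)) = 2 * (y * Real.sinc y) ^ 2 := by
    rw [← hsin, Real.sin_sq_eq_half_sub, show a / ((N : ℝ) + 1) = 2 * y by rw [hy]; ring]
    ring
  rw [hcos, hy]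
  ring

theorem tendsto_sum_sineMode {d : ℕ → ℕ → ℝ} {C : ℝ}
    (hd : ∀ᶠ N in atTop, ∀ y < N, |d N (y + 1)| ≤ C) {x : ℕ → ℕ} {s : ℕ → ℝ} {q : ℝ} (hq : 0 < q)
    (hqs : ∀ᶠ N : ℕ in atTop, q * ((N : ℝ) + 1) ^ 2 ≤ 2 * s N) {f : ℕ → ℝ}
    (hlim : ∀ k, Tendsto (fun N => sineMode N (d N) k (x N) (s N)) atTop (𝓝 (f k))) :
    Tendsto (fun N => ∑ k ∈ Finset.range N, sineMode N (d N) k (x N) (s N)) atTop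
      (𝓝 (∑' k, f k)) := by
  have hsummable : Summable fun k : ℕ => 2 * C * Real.exp (-(((k : ℝ) + 1) * q)) := by
    have hgeom := (Real.summable_exp_nat_mul_iff (a := -q)).2 (by linarith)
    refine (((summable_nat_add_iff 1).2 hgeom).mul_left (2 * C)).congr fun k => ?_
    push_cast
    ring_nf
  have htsum : ∀ N, ∑' k, (if k < N then sineMode N (d N) k (x N) (s N) else 0)
      = ∑ k ∈ Finset.range N, sineMode N (d N) k (x N) (s N) := fun N => by
    rw [tsum_eq_sum (s := Finset.range N) fun k hk => if_neg (by simpa using hk)]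
    exact Finset.sum_congr rfl fun k hk => if_pos (Finset.mem_range.1 hk)
  refine (tendsto_tsum_of_dominated_convergence hsummable (fun k => (hlim k).congr' ?_) ?_).congr
    htsum
  · filter_upwards [eventually_gt_atTop k] with N hN
    rw [if_pos hN]
  · filter_upwards [hqs, hd, eventually_gt_atTop 0] with N hqN hdN hN k
    have hC : 0 ≤ C := (abs_nonneg _).trans (hdN 0 hN)
    split_ifs with hk
    · exact abs_sineMode_le hdN hk _ (by nlinarith [sq_nonneg ((N : ℝ) + 1)]) hqN
    · rw [norm_zero]
      positivity

/-- The `(k + 1)`-st mode of a trigonometric series solution of the heat equation. The profile `φ`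
is a parameter so that the differentiated series, with `cos` and `-sin`, are covered as well. -/
noncomputable def heatMode (c : ℕ → ℝ) (φ : ℝ → ℝ) (k : ℕ) (r t : ℝ) : ℝ :=
  c k * Real.exp (-(((k + 1) * Real.pi) ^ 2 / 2 * t)) * φ ((k + 1) * Real.pi * r)

/-- The trigonometric series with coefficients `c` evolving under the heat equation. -/
noncomputable def heatSeries (c : ℕ → ℝ) (φ : ℝ → ℝ) (r t : ℝ) : ℝ :=
  ∑' k : ℕ, heatMode c φ k r t

/-- The `(k + 1)`-st sine coefficient of the deviation of `u₀` from the stationary profile. -/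
noncomputable def limitCoeff (u₀ : ℝ → ℝ) (a b : ℝ) (k : ℕ) : ℝ :=
  2 * ∫ z in (0 : ℝ)..1, (u₀ z - stationaryProfile a b z) * Real.sin ((k + 1) * Real.pi * z)

/-- The solution of the heat equation `u_t = u_rr / 2` on `[0, 1]` with initial values `u₀` and
boundary values `a` at `0` and `b` at `1`, as a Fourier series. -/
noncomputable def heatSolution (u₀ : ℝ → ℝ) (a b r t : ℝ) : ℝ :=
  stationaryProfile a b r + heatSeries (limitCoeff u₀ a b) Real.sin r t

theorem tendsto_stationaryProfile (a b : ℝ) {x : ℕ → ℝ} {r : ℝ} (hx : Tendsto x atTop (𝓝 r)) :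
    Tendsto (fun N => stationaryProfile a b (x N)) atTop (𝓝 (stationaryProfile a b r)) :=
  (hx.const_mul (b - a)).add_const a

section Limits

variable {u₀ : ℝ → ℝ} {a b C r t : ℝ} {d : ℕ → ℕ → ℝ}

theorem tendsto_sineCoeff_deviation (hd : ∀ᶠ N in atTop, ∀ y < N, |d N (y + 1)| ≤ C)
    (hlim : ∀ z ∈ Set.Ioo (0 : ℝ) 1,
      Tendsto (fun N : ℕ => d N (⌊(N : ℝ) * z⌋₊ + 1)) atTop (𝓝 (u₀ z))) (k : ℕ) :
    Tendsto (fun N => sineCoeff N (deviation N a b (d N)) k) atTop (𝓝 (limitCoeff u₀ a b k)) := by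
  have hriemann : Tendsto (fun N : ℕ => (∑ y ∈ Finset.range N, deviation N a b (d N) (y + 1) *
      Real.sin ((k + 1) * Real.pi * ((y + 1 : ℕ) / (N + 1)))) / N) atTop
      (𝓝 (∫ z in (0 : ℝ)..1, (u₀ z - stationaryProfile a b z) *
        Real.sin ((k + 1) * Real.pi * z))) := by
    refine tendsto_riemann_sum (C := C + (|a| + |b|)) ?_ fun z hz => ?_
    · filter_upwards [hd] with N hdN y hy
      rw [abs_mul]
      exact (mul_le_of_le_one_right (abs_nonneg _) (Real.abs_sin_le_one _)).trans
        (abs_deviation_le a b hdN y hy)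
    · have hsite := tendsto_div_add_one_of_tendsto_div (tendsto_floor_add_one_div hz.1.le)
      exact ((hlim z hz).sub (tendsto_stationaryProfile a b hsite)).mul
        ((Real.continuous_sin.tendsto _).comp (hsite.const_mul ((k + 1) * Real.pi)))
  have hscaled := (tendsto_natCast_div_add_one.mul hriemann).const_mul 2
  rw [one_mul] at hscaled
  refine hscaled.congr' ?_
  filter_upwards [eventually_ne_atTop 0] with N hN
  have hN' : (N : ℝ) ≠ 0 := Nat.cast_ne_zero.2 hN
  rw [sineCoeff]
  field_simp

theorem tendsto_dirichletSolution_diffusive (hd : ∀ᶠ N in atTop, ∀ y < N, |d N (y + 1)| ≤ C)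
    (hlim : ∀ z ∈ Set.Ioo (0 : ℝ) 1,
      Tendsto (fun N : ℕ => d N (⌊(N : ℝ) * z⌋₊ + 1)) atTop (𝓝 (u₀ z)))
    (hr : 0 ≤ r) (ht : 0 < t) :
    Tendsto (fun N : ℕ => dirichletSolution N a b (d N) ⌊(N : ℝ) * r⌋₊ ((N : ℝ) ^ 2 * t)) atTop
      (𝓝 (heatSolution u₀ a b r t)) := by
  have hsite := tendsto_div_add_one_of_tendsto_div (tendsto_floor_div hr)
  have hrate : ∀ᶠ N : ℕ in atTop, t / 2 * ((N : ℝ) + 1) ^ 2 ≤ 2 * ((N : ℝ) ^ 2 * t) := by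
    filter_upwards [eventually_ge_atTop 1] with N hN
    have hN' : (1 : ℝ) ≤ N := by exact_mod_cast hN
    have hsq : ((N : ℝ) + 1) ^ 2 ≤ (2 * N) ^ 2 := by
      gcongr
      linarith
    nlinarith
  refine (tendsto_stationaryProfile a b hsite).add
    (tendsto_sum_sineMode (hd.mono fun N => abs_deviation_le a b) (half_pos ht) hrate fun k => ?_)
  have hexp := ((tendsto_one_sub_cos_mul_sq ((k + 1) * Real.pi)).mul_const t).neg
  simp only [mul_assoc _ ((_ : ℝ) ^ 2) t] at hexp
  exact ((tendsto_sineCoeff_deviation hd hlim k).mul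
    ((Real.continuous_exp.tendsto _).comp hexp)).mul
    ((Real.continuous_sin.tendsto _).comp (hsite.const_mul ((k + 1) * Real.pi)))

theorem tendsto_dirichletSolution_stationary (hd : ∀ᶠ N in atTop, ∀ y < N, |d N (y + 1)| ≤ C)
    {s : ℕ → ℝ} (hs : Tendsto (fun N : ℕ => s N / (N : ℝ) ^ 2) atTop atTop) (hr : 0 ≤ r) :
    Tendsto (fun N : ℕ => dirichletSolution N a b (d N) ⌊(N : ℝ) * r⌋₊ (s N)) atTop
      (𝓝 (stationaryProfile a b r)) := by
  set q : ℕ → ℝ := fun N => 2 * s N / ((N : ℝ) + 1) ^ 2 with hq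
  have hq_top : Tendsto q atTop atTop := by
    refine (hs.atTop_mul_pos two_pos
      ((tendsto_natCast_div_add_one.pow 2).const_mul 2 |>.trans (by simp))).congr' ?_
    filter_upwards [eventually_ne_atTop 0] with N hN
    have hN' : (N : ℝ) ≠ 0 := Nat.cast_ne_zero.2 hN
    simp only [hq]
    field_simp
  have hq_mul : ∀ N : ℕ, q N * ((N : ℝ) + 1) ^ 2 = 2 * s N := fun N =>
    div_mul_cancel₀ _ (by positivity)
  have hseries : Tendsto (fun N : ℕ => ∑ k ∈ Finset.range N,
      sineMode N (deviation N a b (d N)) k ⌊(N : ℝ) * r⌋₊ (s N)) atTop (𝓝 (∑' _ : ℕ, 0)) := by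
    refine tendsto_sum_sineMode (hd.mono fun N => abs_deviation_le a b) one_pos ?_ fun k => ?_
    · filter_upwards [hq_top.eventually_ge_atTop 1] with N hqN
      rw [← hq_mul]
      gcongr
    · have hdecay : Tendsto (fun N : ℕ =>
          2 * (C + (|a| + |b|)) * Real.exp (-(((k : ℝ) + 1) * q N))) atTop (𝓝 0) := by
        simpa only [Function.comp_def, mul_zero] using (Real.tendsto_exp_neg_atTop_nhds_zero.comp
          (hq_top.const_mul_atTop (by positivity : (0 : ℝ) < k + 1))).const_mul _
      refine squeeze_zero_norm' ?_ hdecay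
      filter_upwards [eventually_gt_atTop k, hd, hq_top.eventually_ge_atTop 0] with N hN hdN hqN
      exact abs_sineMode_le (abs_deviation_le a b hdN) hN _
        (by nlinarith [hq_mul N, sq_nonneg ((N : ℝ) + 1)]) (hq_mul N).le
  have hsum := (tendsto_stationaryProfile a b
    (tendsto_div_add_one_of_tendsto_div (tendsto_floor_div hr))).add hseries
  rwa [tsum_zero, add_zero] at hsum

end Limits

/-! ### Trigonometric series solutions of the heat equation -/

/-- Polynomial growth of the coefficients of a trigonometric series, which is what makes the heat
series smooth at positive times. -/
def PolyBounded (c : ℕ → ℝ) : Prop := ∃ (C : ℝ) (m : ℕ), ∀ k : ℕ, |c k| ≤ C * ((k : ℝ) + 1) ^ m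

namespace PolyBounded

variable {c : ℕ → ℝ} {φ : ℝ → ℝ}

theorem mul_freq (hc : PolyBounded c) : PolyBounded fun k => c k * ((k + 1) * Real.pi) := by
  obtain ⟨C, m, hC⟩ := hc
  refine ⟨C * Real.pi, m + 1, fun k => ?_⟩
  have hfreq : (0 : ℝ) ≤ (k + 1) * Real.pi := mul_nonneg (by positivity) Real.pi_pos.le
  calc |c k * ((k + 1) * Real.pi)| = |c k| * ((k + 1) * Real.pi) := by
        rw [abs_mul, abs_of_nonneg hfreq]
    _ ≤ C * ((k : ℝ) + 1) ^ m * ((k + 1) * Real.pi) := by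
        gcongr
        exact hC k
    _ = C * Real.pi * ((k : ℝ) + 1) ^ (m + 1) := by ring

theorem const_mul (hc : PolyBounded c) (a : ℝ) : PolyBounded fun k => a * c k := by
  obtain ⟨C, m, hC⟩ := hc
  refine ⟨|a| * C, m, fun k => ?_⟩
  rw [abs_mul, mul_assoc]
  gcongr
  exact hC k

theorem exists_summable_bound (hc : PolyBounded c) (hφ : ∀ x, |φ x| ≤ 1) {τ : ℝ} (hτ : 0 < τ) :
    ∃ U : ℕ → ℝ, Summable U ∧ ∀ k : ℕ, ∀ r : ℝ, ∀ t ≥ τ, ‖heatMode c φ k r t‖ ≤ U k := by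
  obtain ⟨C, m, hC⟩ := hc
  refine ⟨fun k => C * (((k + 1 : ℕ) : ℝ) ^ m * Real.exp (-τ * (k + 1 : ℕ))),
    ((summable_nat_add_iff 1).2 (Real.summable_pow_mul_exp_neg_nat_mul m hτ)).mul_left C,
    fun k r t ht => ?_⟩
  have ht₀ : 0 ≤ t := hτ.le.trans ht
  have hpi : 2 ≤ Real.pi ^ 2 := by nlinarith [Real.pi_gt_three]
  have hrate : τ * ((k : ℝ) + 1) ≤ ((k + 1) * Real.pi) ^ 2 / 2 * t :=
    calc τ * ((k : ℝ) + 1) ≤ t * ((k : ℝ) + 1) ^ 2 := by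
          gcongr
          exact le_self_pow₀ (by linarith [k.cast_nonneg (α := ℝ)]) two_ne_zero
      _ = ((k : ℝ) + 1) ^ 2 * 2 / 2 * t := by ring
      _ ≤ ((k : ℝ) + 1) ^ 2 * Real.pi ^ 2 / 2 * t := by gcongr
      _ = ((k + 1) * Real.pi) ^ 2 / 2 * t := by ring
  have hbound : 0 ≤ C * ((k : ℝ) + 1) ^ m := (abs_nonneg _).trans (hC k)
  rw [heatMode, Real.norm_eq_abs, abs_mul, abs_mul, Real.abs_exp]
  calc |c k| * Real.exp (-(((k + 1) * Real.pi) ^ 2 / 2 * t)) * |φ ((k + 1) * Real.pi * r)|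
      ≤ C * ((k : ℝ) + 1) ^ m * Real.exp (-(τ * (k + 1))) * 1 := by
        gcongr
        · exact hC k
        · exact hφ _
    _ = C * (((k + 1 : ℕ) : ℝ) ^ m * Real.exp (-τ * (k + 1 : ℕ))) := by
        push_cast
        ring_nf

theorem summable_heatMode (hc : PolyBounded c) (hφ : ∀ x, |φ x| ≤ 1) (r : ℝ) {t : ℝ}
    (ht : 0 < t) : Summable fun k => heatMode c φ k r t := by
  obtain ⟨U, hU, hle⟩ := hc.exists_summable_bound hφ ht
  exact Summable.of_norm_bounded hU fun k => hle k r t le_rfl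

theorem continuousOn_heatSeries (hc : PolyBounded c) (hφ : ∀ x, |φ x| ≤ 1) (hφc : Continuous φ) :
    ContinuousOn (Function.uncurry (heatSeries c φ)) (Set.Icc 0 1 ×ˢ Set.Ioi 0) := by
  rintro ⟨r, t⟩ ⟨-, ht⟩
  obtain ⟨U, hU, hle⟩ := hc.exists_summable_bound hφ (half_pos ht)
  have hnhds : (Set.univ : Set ℝ) ×ˢ Set.Ioi (t / 2) ∈ 𝓝 (r, t) :=
    (isOpen_univ.prod isOpen_Ioi).mem_nhds ⟨trivial, half_lt_self (Set.mem_Ioi.1 ht)⟩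
  refine (ContinuousOn.continuousAt (s := Set.univ ×ˢ Set.Ioi (t / 2)) ?_ hnhds).continuousWithinAt
  refine continuousOn_tsum (fun k => ?_) hU fun k p hp => hle k p.1 p.2 (le_of_lt hp.2)
  unfold heatMode
  fun_prop

theorem hasDerivAt_heatSeries_space {ψ : ℝ → ℝ} (hc : PolyBounded c) (hφ : ∀ x, |φ x| ≤ 1)
    (hψ : ∀ x, |ψ x| ≤ 1) (hd : ∀ x, HasDerivAt φ (ψ x) x) (r : ℝ) {t : ℝ} (ht : 0 < t) :
    HasDerivAt (fun r => heatSeries c φ r t)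
      (heatSeries (fun k => c k * ((k + 1) * Real.pi)) ψ r t) r := by
  obtain ⟨U, hU, hle⟩ := hc.mul_freq.exists_summable_bound hψ ht
  refine hasDerivAt_tsum (y₀ := 0) (g := fun k r => heatMode c φ k r t) hU (fun k y => ?_)
    (fun k y => hle k y t le_rfl) (hc.summable_heatMode hφ 0 ht) r
  have hphase : HasDerivAt (fun y : ℝ => ((k : ℝ) + 1) * Real.pi * y) ((k + 1) * Real.pi) y := by
    simpa using (hasDerivAt_id y).const_mul (((k : ℝ) + 1) * Real.pi)
  refine (((hd _).comp y hphase).const_mul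
    (c k * Real.exp (-(((k + 1) * Real.pi) ^ 2 / 2 * t)))).congr_deriv ?_
  rw [heatMode]
  ring

theorem hasDerivAt_heatSeries_time (hc : PolyBounded c) (hφ : ∀ x, |φ x| ≤ 1) (r : ℝ) {t : ℝ}
    (ht : 0 < t) : HasDerivAt (fun t => heatSeries c φ r t)
      (1 / 2 * heatSeries (fun k => c k * ((k + 1) * Real.pi) * ((k + 1) * Real.pi))
        (fun x => -φ x) r t) t := by
  obtain ⟨U, hU, hle⟩ := (hc.mul_freq.mul_freq.const_mul (1 / 2)).exists_summable_bound
    (φ := fun x => -φ x) (fun x => (abs_neg _).trans_le (hφ x)) (half_pos ht)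
  have hmode : ∀ k s, HasDerivAt (fun s => heatMode c φ k r s)
      (heatMode (fun k => 1 / 2 * (c k * ((k + 1) * Real.pi) * ((k + 1) * Real.pi)))
        (fun x => -φ x) k r s) s := fun k s => by
    have hexponent : HasDerivAt (fun s : ℝ => -((((k : ℝ) + 1) * Real.pi) ^ 2 / 2 * s))
        (-(((k + 1) * Real.pi) ^ 2 / 2)) s := by
      simpa using ((hasDerivAt_id s).const_mul ((((k : ℝ) + 1) * Real.pi) ^ 2 / 2)).fun_neg
    refine ((hexponent.exp.const_mul (c k)).mul_const
      (φ ((k + 1) * Real.pi * r))).congr_deriv ?_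
    rw [heatMode]
    ring
  refine (hasDerivAt_tsum_of_isPreconnected (y₀ := t) hU isOpen_Ioi isPreconnected_Ioi
    (fun k s _ => hmode k s) (fun k s hs => hle k r s (le_of_lt hs)) (half_lt_self ht)
    (hc.summable_heatMode hφ r ht) (half_lt_self ht)).congr_deriv ?_
  rw [heatSeries, ← tsum_mul_left]
  exact tsum_congr fun k => by simp only [heatMode, mul_assoc]

end PolyBounded

theorem heatSeries_sin_zero (c : ℕ → ℝ) (t : ℝ) : heatSeries c Real.sin 0 t = 0 := by
  simp [heatSeries, heatMode]

theorem heatSeries_sin_one (c : ℕ → ℝ) (t : ℝ) : heatSeries c Real.sin 1 t = 0 := by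
  have hnode : ∀ k : ℕ, Real.sin ((k + 1) * Real.pi) = 0 := fun k => by
    exact_mod_cast Real.sin_nat_mul_pi (k + 1)
  simp [heatSeries, heatMode, hnode]

section HeatSolution

variable {u₀ : ℝ → ℝ} {C : ℝ}

theorem polyBounded_limitCoeff (a b : ℝ) (hC : ∀ z ∈ Set.Ioo (0 : ℝ) 1, |u₀ z| ≤ C) :
    PolyBounded (limitCoeff u₀ a b) := by
  refine ⟨2 * (C + (|a| + |b|)), 0, fun k => ?_⟩
  have hle := intervalIntegral.norm_integral_le_of_norm_le_const_ae (a := 0) (b := 1)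
    (f := fun z => (u₀ z - stationaryProfile a b z) * Real.sin ((k + 1) * Real.pi * z))
    (C := C + (|a| + |b|)) <| by
      filter_upwards [ae_mem_Ioo_of_mem_uIoc] with z hz hz'
      rw [Real.norm_eq_abs, abs_mul]
      exact (mul_le_of_le_one_right (abs_nonneg _) (Real.abs_sin_le_one _)).trans <|
        (abs_sub _ _).trans <| add_le_add (hC z (hz hz'))
          (abs_stationaryProfile_le a b (Set.Ioo_subset_Icc_self (hz hz')))
  rw [sub_zero, abs_one, mul_one, Real.norm_eq_abs] at hle
  rw [limitCoeff, abs_mul, abs_two, pow_zero, mul_one]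
  gcongr

theorem abs_dirichletSolution_sub_le {N : ℕ} {a b c ε K r t : ℝ} {d : ℕ → ℝ} (hK : 0 ≤ K)
    (hd : ∀ y < N, |d (y + 1) - c| ≤ ε + K * (((y + 1 : ℕ) : ℝ) / (N + 1) - r) ^ 2)
    (ha : |a - c| ≤ ε + K * (0 - r) ^ 2) (hb : |b - c| ≤ ε + K * (1 - r) ^ 2)
    {x : ℕ} (hx : x ≤ N + 1) (ht : 0 ≤ t) :
    |dirichletSolution N a b d x t - c| ≤ ε + K * ((x / (N + 1) - r) ^ 2 + t / (N + 1) ^ 2) := by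
  have hconst : IsDiscreteHeat N fun _ _ => c := by
    simpa only [zero_mul, zero_add] using IsDiscreteHeat.affine N 0 c
  have hgrow : ∀ s ∈ Set.Icc 0 t, ∀ q : ℝ, ε + K * q ≤ ε + K * (q + s / ((N : ℝ) + 1) ^ 2) :=
    fun s hs q => by
    gcongr
    exact le_add_of_nonneg_right (div_nonneg hs.1 (by positivity))
  refine (isDiscreteHeat_dirichletSolution N a b d).abs_sub_le hconst
    (IsDiscreteHeat.quadratic N ε K (N + 1) r) (fun y hy => ?_) (fun s hs => ?_) (fun s hs => ?_)
    hx (Set.right_mem_Icc.2 ht)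
  · simpa only [dirichletSolution_initial a b d hy, zero_div, add_zero] using hd y hy
  · rw [dirichletSolution_left, Nat.cast_zero, zero_div]
    exact ha.trans (hgrow s hs _)
  · rw [dirichletSolution_right, Nat.cast_succ, div_self (by positivity)]
    exact hb.trans (hgrow s hs _)

/-- The quadratic barrier survives the limit `N → ∞`, so the maximum principle for the continuous
equation is not needed. -/
theorem abs_heatSolution_sub_le {a b c ε K r t : ℝ} (hu₀ : ContinuousOn u₀ (Set.Ioo 0 1))
    (hK : 0 ≤ K) (hinit : ∀ z ∈ Set.Ioo (0 : ℝ) 1, |u₀ z - c| ≤ ε + K * (z - r) ^ 2)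
    (ha : |a - c| ≤ ε + K * (0 - r) ^ 2) (hb : |b - c| ≤ ε + K * (1 - r) ^ 2)
    (hr : r ∈ Set.Icc (0 : ℝ) 1) (ht : 0 < t) :
    |heatSolution u₀ a b r t - c| ≤ ε + K * t := by
  set d : ℕ → ℕ → ℝ := fun N y => u₀ (y / (N + 1))
  have hsite : ∀ N : ℕ, ∀ y < N, ((y + 1 : ℕ) : ℝ) / (N + 1) ∈ Set.Ioo (0 : ℝ) 1 := fun N y hy =>
    ⟨by positivity, (div_lt_one (by positivity)).2 (by exact_mod_cast Nat.succ_lt_succ hy)⟩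
  have hbound : ∀ N, ∀ y < N, |d N (y + 1)| ≤ ε + K + |c| := fun N y hy => by
    have hz := hsite N y hy
    have hsq : (((y + 1 : ℕ) : ℝ) / (N + 1) - r) ^ 2 ≤ 1 :=
      (sq_le_one_iff_abs_le_one _).2 (abs_le.2 ⟨by linarith [hz.1, hr.2], by linarith [hz.2, hr.1]⟩)
    nlinarith [hinit _ hz, abs_sub_abs_le_abs_sub (u₀ (((y + 1 : ℕ) : ℝ) / (N + 1))) c]
  have hlim := tendsto_dirichletSolution_diffusive (a := a) (b := b) (Eventually.of_forall hbound)
    (fun z hz => (hu₀.continuousAt (Ioo_mem_nhds hz.1 hz.2)).tendsto.comp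
      (tendsto_div_add_one_of_tendsto_div (tendsto_floor_add_one_div hz.1.le))) hr.1 ht
  have hbarrier := (((((tendsto_div_add_one_of_tendsto_div (tendsto_floor_div hr.1)).sub_const
    r).pow 2).add ((tendsto_natCast_div_add_one.pow 2).mul_const t)).const_mul K).const_add ε
  rw [sub_self, zero_pow two_ne_zero, one_pow, one_mul, zero_add] at hbarrier
  refine le_of_tendsto_of_tendsto' (hlim.sub_const c).abs hbarrier fun N => ?_
  rw [div_pow, div_mul_eq_mul_div]
  exact abs_dirichletSolution_sub_le hK (fun y hy => hinit _ (hsite N y hy)) ha hb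
    ((floor_mul_le N hr.2).trans N.le_succ) (by positivity)

theorem exists_quadratic_modulus {f : ℝ → ℝ} {s : Set ℝ} {r ε : ℝ} (hf : ContinuousAt f r)
    (hC : ∀ z ∈ s, |f z| ≤ C) (hr : r ∈ s) (hε : 0 < ε) :
    ∃ K, 0 ≤ K ∧ ∀ z ∈ s, |f z - f r| ≤ ε + K * (z - r) ^ 2 := by
  obtain ⟨δ, hδ, hclose⟩ := Metric.continuousAt_iff.1 hf ε hε
  have hC₀ : 0 ≤ C := (abs_nonneg _).trans (hC r hr)
  refine ⟨2 * C / δ ^ 2, by positivity, fun z hz => ?_⟩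
  rcases lt_or_ge (dist z r) δ with hnear | hfar
  · have hquad : 0 ≤ 2 * C / δ ^ 2 * (z - r) ^ 2 := by positivity
    exact (hclose hnear).le.trans (le_add_of_nonneg_right hquad)
  · have hsq : δ ^ 2 ≤ (z - r) ^ 2 := by
      rw [← sq_abs (z - r)]
      exact pow_le_pow_left₀ hδ.le hfar 2
    calc |f z - f r| ≤ |f z| + |f r| := abs_sub _ _
      _ ≤ 2 * C / δ ^ 2 * δ ^ 2 := by
        rw [div_mul_cancel₀ _ (pow_pos hδ 2).ne']
        linarith [hC z hz, hC r hr]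
      _ ≤ 2 * C / δ ^ 2 * (z - r) ^ 2 := by gcongr
      _ ≤ ε + 2 * C / δ ^ 2 * (z - r) ^ 2 := le_add_of_nonneg_left hε.le

theorem tendsto_heatSolution_zero (hu₀ : ContinuousOn u₀ (Set.Ioo 0 1))
    (hC : ∀ z ∈ Set.Ioo (0 : ℝ) 1, |u₀ z| ≤ C) (a b : ℝ) {r : ℝ} (hr : r ∈ Set.Ioo (0 : ℝ) 1) :
    Tendsto (fun t => heatSolution u₀ a b r t) (𝓝[>] 0) (𝓝 (u₀ r)) := by
  set f : ℝ → ℝ := Function.update (Function.update u₀ 0 a) 1 b with hf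
  have hf_interior : ∀ z ∈ Set.Ioo (0 : ℝ) 1, f z = u₀ z := fun z hz => by
    rw [hf, Function.update_of_ne hz.2.ne, Function.update_of_ne hz.1.ne']
  have hf_zero : f 0 = a := by
    rw [hf, Function.update_of_ne zero_ne_one, Function.update_self]
  have hf_one : f 1 = b := Function.update_self ..
  have hf_cont : ContinuousAt f r := by
    rw [hf, continuousAt_update_of_ne hr.2.ne, continuousAt_update_of_ne hr.1.ne']
    exact hu₀.continuousAt (Ioo_mem_nhds hr.1 hr.2)
  have hf_bound : ∀ z ∈ Set.Icc (0 : ℝ) 1, |f z| ≤ max C (max |a| |b|) := fun z hz => by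
    rcases hz.1.eq_or_lt with rfl | hz₀
    · simp [hf_zero]
    rcases hz.2.eq_or_lt with rfl | hz₁
    · simp [hf_one]
    · exact (hf_interior z ⟨hz₀, hz₁⟩).symm ▸ (hC z ⟨hz₀, hz₁⟩).trans (le_max_left _ _)
  refine Metric.tendsto_nhds.2 fun ε hε => ?_
  obtain ⟨K, hK, hmodulus⟩ :=
    exists_quadratic_modulus hf_cont hf_bound (Set.Ioo_subset_Icc_self hr) (half_pos hε)
  rw [hf_interior r hr] at hmodulus
  have hsmall : ∀ᶠ t in 𝓝[>] (0 : ℝ), ε / 2 + K * t < ε := by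
    have hlim : Tendsto (fun t => ε / 2 + K * t) (𝓝[>] 0) (𝓝 (ε / 2 + K * 0)) :=
      ((tendsto_id.mono_left nhdsWithin_le_nhds).const_mul K).const_add _
    exact hlim.eventually_lt_const (by linarith)
  filter_upwards [hsmall, self_mem_nhdsWithin] with t hsmall_t ht
  refine (abs_heatSolution_sub_le hu₀ hK (fun z hz => ?_) ?_ ?_ (Set.Ioo_subset_Icc_self hr)
    ht).trans_lt hsmall_t
  · exact hf_interior z hz ▸ hmodulus z (Set.Ioo_subset_Icc_self hz)
  · exact hf_zero ▸ hmodulus 0 (Set.left_mem_Icc.2 zero_le_one)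
  · exact hf_one ▸ hmodulus 1 (Set.right_mem_Icc.2 zero_le_one)

theorem abs_heatSolution_le (hu₀ : ContinuousOn u₀ (Set.Ioo 0 1))
    (hC : ∀ z ∈ Set.Ioo (0 : ℝ) 1, |u₀ z| ≤ C) (a b : ℝ) {r t : ℝ} (hr : r ∈ Set.Icc (0 : ℝ) 1)
    (ht : 0 < t) : |heatSolution u₀ a b r t| ≤ max C (max |a| |b|) := by
  have hle := abs_heatSolution_sub_le (a := a) (b := b) (c := 0) (ε := max C (max |a| |b|)) hu₀
    le_rfl (fun z hz => ?_) ?_ ?_ hr ht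
  · simpa only [sub_zero, zero_mul, add_zero] using hle
  · simpa only [sub_zero, zero_mul, add_zero] using (hC z hz).trans (le_max_left _ _)
  all_goals simp

theorem isHeatSolution_heatSolution (hu₀ : ContinuousOn u₀ (Set.Ioo 0 1))
    (hC : ∀ z ∈ Set.Ioo (0 : ℝ) 1, |u₀ z| ≤ C) (a b : ℝ) :
    IsHeatSolution u₀ a b (heatSolution u₀ a b) where
  bounded := ⟨_, fun _ hr _ ht => abs_heatSolution_le hu₀ hC a b hr ht⟩
  continuousOn :=
    (Continuous.continuousOn (by unfold stationaryProfile; fun_prop :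
      Continuous fun p : ℝ × ℝ => stationaryProfile a b p.1)).add
      ((polyBounded_limitCoeff a b hC).continuousOn_heatSeries Real.abs_sin_le_one
        Real.continuous_sin)
  equation := by
    have hc := polyBounded_limitCoeff a b hC
    have hneg_sin : ∀ x, |-Real.sin x| ≤ 1 := fun x =>
      (abs_neg _).trans_le (Real.abs_sin_le_one x)
    refine ⟨fun r t => (b - a) +
        heatSeries (fun k => limitCoeff u₀ a b k * ((k + 1) * Real.pi)) Real.cos r t,
      heatSeries (fun k => limitCoeff u₀ a b k * ((k + 1) * Real.pi) * ((k + 1) * Real.pi))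
        (fun x => -Real.sin x),
      hc.mul_freq.mul_freq.continuousOn_heatSeries hneg_sin Real.continuous_sin.neg,
      fun r _ t ht => ⟨?_, ?_, ?_⟩⟩
    · have hprofile : HasDerivAt (stationaryProfile a b) (b - a) r :=
        (((hasDerivAt_id r).const_mul (b - a)).add_const a).congr_deriv (mul_one _)
      exact (hprofile.fun_add (hc.hasDerivAt_heatSeries_space Real.abs_sin_le_one
        Real.abs_cos_le_one Real.hasDerivAt_sin r ht)).hasDerivWithinAt
    · exact ((hc.mul_freq.hasDerivAt_heatSeries_space Real.abs_cos_le_one hneg_sin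
        Real.hasDerivAt_cos r ht).const_add (b - a)).hasDerivWithinAt
    · exact (hc.hasDerivAt_heatSeries_time Real.abs_sin_le_one r ht).const_add _
  left_boundary t _ := by
    rw [heatSolution, stationaryProfile_zero, heatSeries_sin_zero, add_zero]
  right_boundary t _ := by
    rw [heatSolution, stationaryProfile_one, heatSeries_sin_one, add_zero]
  initial _ hr := tendsto_heatSolution_zero hu₀ hC a b hr

end HeatSolution

/-! ### Uniqueness for the heat equation -/

theorem continuousOn_slice {u : ℝ → ℝ → ℝ}
    (hu : ContinuousOn (Function.uncurry u) (Set.Icc 0 1 ×ˢ Set.Ioi 0)) {t : ℝ} (ht : 0 < t) :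
    ContinuousOn (fun r => u r t) (Set.uIcc 0 1) := by
  rw [Set.uIcc_of_le zero_le_one]
  exact hu.comp (f := fun r : ℝ => (r, t)) (by fun_prop) fun r hr => ⟨hr, ht⟩

theorem integral_mul_second_deriv_nonpos {f f' f'' : ℝ → ℝ} {a b : ℝ} (hab : a ≤ b)
    (hf : ∀ x ∈ Set.uIcc a b, HasDerivWithinAt f (f' x) (Set.uIcc a b) x)
    (hf' : ∀ x ∈ Set.uIcc a b, HasDerivWithinAt f' (f'' x) (Set.uIcc a b) x)
    (hf'' : IntervalIntegrable f'' volume a b) (ha : f a = 0) (hb : f b = 0) :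
    ∫ x in a..b, f x * f'' x ≤ 0 := by
  have hf'_cont : ContinuousOn f' (Set.uIcc a b) := fun x hx => (hf' x hx).continuousWithinAt
  rw [intervalIntegral.integral_mul_deriv_eq_deriv_mul_of_hasDerivWithinAt hf hf'
    hf'_cont.intervalIntegrable hf'', ha, hb, zero_mul, zero_mul, sub_zero, zero_sub,
    Left.neg_nonpos_iff]
  exact intervalIntegral.integral_nonneg hab fun x _ => mul_self_nonneg _

/-- The energy `∫ u(r, t)² dr` of a function on `[0, 1]` at time `t`. -/
noncomputable def energy (u : ℝ → ℝ → ℝ) (t : ℝ) : ℝ := ∫ r in (0 : ℝ)..1, u r t ^ 2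

theorem hasDerivAt_energy {u v : ℝ → ℝ → ℝ}
    (hu : ContinuousOn (Function.uncurry u) (Set.Icc 0 1 ×ˢ Set.Ioi 0))
    (hv : ContinuousOn (Function.uncurry v) (Set.Icc 0 1 ×ˢ Set.Ioi 0))
    (huv : ∀ r ∈ Set.Icc (0 : ℝ) 1, ∀ t > 0, HasDerivAt (u r) (1 / 2 * v r t) t)
    {t : ℝ} (ht : 0 < t) : HasDerivAt (energy u) (∫ r in (0 : ℝ)..1, u r t * v r t) t := by
  have hpos : ∀ s ∈ Set.Icc (t / 2) (2 * t), 0 < s := fun s hs => (half_pos ht).trans_le hs.1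
  have hmem : ∀ r ∈ Set.uIoc (0 : ℝ) 1, r ∈ Set.Icc (0 : ℝ) 1 := fun r hr =>
    Set.Ioc_subset_Icc_self (Set.uIoc_of_le (zero_le_one' ℝ) ▸ hr)
  obtain ⟨B, hB⟩ := (isCompact_Icc.prod isCompact_Icc).exists_bound_of_continuousOn
    ((hu.mul hv).mono (Set.prod_mono subset_rfl hpos))
  refine (intervalIntegral.hasDerivAt_integral_of_dominated_loc_of_deriv_le
    (s := Set.Icc (t / 2) (2 * t)) (F := fun s r => u r s ^ 2)
    (F' := fun s r => u r s * v r s) (bound := fun _ => B)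
    (Icc_mem_nhds (half_lt_self ht) (by linarith)) ?_ ?_ ?_ ?_ intervalIntegrable_const ?_).2
  · filter_upwards [lt_mem_nhds ht] with s hs
    exact ((continuousOn_slice hu hs).pow 2).intervalIntegrable.def'.aestronglyMeasurable
  · exact ((continuousOn_slice hu ht).pow 2).intervalIntegrable
  · exact ((continuousOn_slice hu ht).mul
      (continuousOn_slice hv ht)).intervalIntegrable.def'.aestronglyMeasurable
  · exact Eventually.of_forall fun r hr s hs => hB (r, s) ⟨hmem r hr, hs⟩
  · refine Eventually.of_forall fun r hr s hs =>
      ((huv r (hmem r hr) s (hpos s hs)).fun_pow 2).congr_deriv ?_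
    push_cast
    ring

namespace IsHeatSolution

variable {u₀ w₀ : ℝ → ℝ} {a b a' b' : ℝ} {u w : ℝ → ℝ → ℝ}

theorem sub (hu : IsHeatSolution u₀ a b u) (hw : IsHeatSolution w₀ a' b' w) :
    IsHeatSolution (fun r => u₀ r - w₀ r) (a - a') (b - b') fun r t => u r t - w r t where
  bounded := by
    obtain ⟨C, hC⟩ := hu.bounded
    obtain ⟨D, hD⟩ := hw.bounded
    exact ⟨C + D, fun r hr t ht => (abs_sub _ _).trans (add_le_add (hC r hr t ht) (hD r hr t ht))⟩
  continuousOn := hu.continuousOn.sub hw.continuousOn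
  equation := by
    obtain ⟨ur, urr, hurr, hu_eq⟩ := hu.equation
    obtain ⟨wr, wrr, hwrr, hw_eq⟩ := hw.equation
    refine ⟨fun r t => ur r t - wr r t, fun r t => urr r t - wrr r t, hurr.sub hwrr,
      fun r hr t ht => ?_⟩
    obtain ⟨hu₁, hu₂, hu₃⟩ := hu_eq r hr t ht
    obtain ⟨hw₁, hw₂, hw₃⟩ := hw_eq r hr t ht
    exact ⟨hu₁.fun_sub hw₁, hu₂.fun_sub hw₂, (hu₃.fun_sub hw₃).congr_deriv (mul_sub _ _ _).symm⟩
  left_boundary t ht := by rw [hu.left_boundary t ht, hw.left_boundary t ht]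
  right_boundary t ht := by rw [hu.right_boundary t ht, hw.right_boundary t ht]
  initial r hr := (hu.initial r hr).sub (hw.initial r hr)

theorem antitoneOn_energy (hu : IsHeatSolution u₀ 0 0 u) :
    AntitoneOn (energy u) (Set.Ioi 0) := by
  obtain ⟨ur, urr, hurr, hu_eq⟩ := hu.equation
  have hderiv : ∀ t > 0, HasDerivAt (energy u) (∫ r in (0 : ℝ)..1, u r t * urr r t) t :=
    fun t ht => hasDerivAt_energy hu.continuousOn hurr (fun r hr s hs => (hu_eq r hr s hs).2.2) ht
  have hnonpos : ∀ t > 0, ∫ r in (0 : ℝ)..1, u r t * urr r t ≤ 0 := fun t ht => by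
    rw [← Set.uIcc_of_le (zero_le_one' ℝ)] at hu_eq
    exact integral_mul_second_deriv_nonpos zero_le_one (fun r hr => (hu_eq r hr t ht).1)
      (fun r hr => (hu_eq r hr t ht).2.1) (continuousOn_slice hurr ht).intervalIntegrable
      (hu.left_boundary t ht) (hu.right_boundary t ht)
  exact antitoneOn_of_hasDerivWithinAt_nonpos (convex_Ioi 0)
    (fun t ht => (hderiv t ht).continuousAt.continuousWithinAt)
    (fun t ht => (hderiv t (interior_subset ht)).hasDerivWithinAt)
    (fun t ht => hnonpos t (interior_subset ht))

theorem tendsto_energy (hu : IsHeatSolution u₀ a b u) :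
    Tendsto (energy u) (𝓝[>] 0) (𝓝 (∫ r in (0 : ℝ)..1, u₀ r ^ 2)) := by
  obtain ⟨C, hC⟩ := hu.bounded
  refine intervalIntegral.tendsto_integral_filter_of_dominated_convergence (fun _ => C ^ 2) ?_ ?_
    intervalIntegrable_const ?_
  · filter_upwards [self_mem_nhdsWithin] with t ht
    exact ((continuousOn_slice hu.continuousOn
      ht).pow 2).intervalIntegrable.def'.aestronglyMeasurable
  · filter_upwards [self_mem_nhdsWithin] with t ht
    filter_upwards [ae_mem_Ioo_of_mem_uIoc] with r hr hr'
    rw [norm_pow, Real.norm_eq_abs]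
    gcongr
    exact hC r (Set.Ioo_subset_Icc_self (hr hr')) t ht
  · filter_upwards [ae_mem_Ioo_of_mem_uIoc] with r hr hr'
    exact (hu.initial r (hr hr')).pow 2

theorem eq_zero (hu : IsHeatSolution (fun _ => 0) 0 0 u) {r : ℝ} (hr : r ∈ Set.Icc (0 : ℝ) 1)
    {t : ℝ} (ht : 0 < t) : u r t = 0 := by
  by_contra hne
  have hslice := continuousOn_slice hu.continuousOn ht
  rw [Set.uIcc_of_le zero_le_one] at hslice
  have hpos : 0 < energy u t :=
    intervalIntegral.integral_pos zero_lt_one (hslice.pow 2) (fun _ _ => sq_nonneg _)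
      ⟨r, hr, sq_pos_of_ne_zero hne⟩
  have hlim : Tendsto (energy u) (𝓝[>] 0) (𝓝 0) := by simpa using hu.tendsto_energy
  refine hpos.not_ge (ge_of_tendsto hlim ?_)
  filter_upwards [Ioo_mem_nhdsGT ht] with s hs
  exact hu.antitoneOn_energy hs.1 ht hs.2.le

theorem unique (hu : IsHeatSolution u₀ a b u) (hw : IsHeatSolution u₀ a b w) {r : ℝ}
    (hr : r ∈ Set.Icc (0 : ℝ) 1) {t : ℝ} (ht : 0 < t) : u r t = w r t := by
  have hdiff := hu.sub hw
  simp only [sub_self] at hdiff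
  exact sub_eq_zero.1 (hdiff.eq_zero hr ht)

end IsHeatSolution

/-! ### The closed system of equations for the densities -/

/-- The densities `R x t`, `0 ≤ x ≤ N + 1`, solve the discrete heat equation in the channel
`{1, …, N}`, and the reservoirs at `0` and `N + 1`, of capacity `M`, absorb the boundary currents.
-/
structure DensitySystem (N : ℕ) (M : ℝ) (R : ℕ → ℝ → ℝ) : Prop where
  interior : IsDiscreteHeat N R
  left : ∀ t, HasDerivAt (R 0) ((R 1 t - R 0 t) / (2 * M)) t
  right : ∀ t, HasDerivAt (R (N + 1)) ((R N t - R (N + 1) t) / (2 * M)) t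
  mem_Icc : ∀ x, ∀ t ≥ 0, R x t ∈ Set.Icc (0 : ℝ) 1

/-- The first moment `∑ x ρ(x, t)` of the density in the channel. -/
def firstMoment (N : ℕ) (R : ℕ → ℝ → ℝ) (t : ℝ) : ℝ :=
  ∑ x ∈ Finset.range N, ((x : ℝ) + 1) * R (x + 1) t

theorem sum_mul_laplacian (r : ℕ → ℝ) (n : ℕ) :
    ∑ x ∈ Finset.range n, ((x : ℝ) + 1) * (r (x + 2) + r x - 2 * r (x + 1))
      = n * r (n + 1) - (n + 1) * r n + r 0 := by
  induction n with
  | zero => simp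
  | succ n ih =>
    rw [Finset.sum_range_succ, ih]
    push_cast
    ring

theorem IsDiscreteHeat.hasDerivAt_firstMoment {N : ℕ} {R : ℕ → ℝ → ℝ} (hR : IsDiscreteHeat N R)
    (t : ℝ) : HasDerivAt (firstMoment N R)
      (1 / 2 * (N * R (N + 1) t - (N + 1) * R N t + R 0 t)) t := by
  refine (HasDerivAt.fun_sum fun x hx =>
    (hR x (Finset.mem_range.1 hx) t).const_mul ((x : ℝ) + 1)).congr_deriv ?_
  rw [← sum_mul_laplacian (fun x => R x t) N, Finset.mul_sum]
  exact Finset.sum_congr rfl fun x _ => by ring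

theorem firstMoment_mem_Icc {N : ℕ} {R : ℕ → ℝ → ℝ} {t : ℝ}
    (hR : ∀ x < N, R (x + 1) t ∈ Set.Icc (0 : ℝ) 1) :
    firstMoment N R t ∈ Set.Icc (0 : ℝ) (N * (N + 1)) := by
  refine ⟨Finset.sum_nonneg fun x hx =>
    mul_nonneg (by positivity) (hR x (Finset.mem_range.1 hx)).1, ?_⟩
  calc firstMoment N R t ≤ ∑ _x ∈ Finset.range N, ((N : ℝ) + 1) := by
        refine Finset.sum_le_sum fun x hx => ?_
        have hxN : (x : ℝ) + 1 ≤ N := by exact_mod_cast Finset.mem_range.1 hx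
        exact (mul_le_of_le_one_right (by positivity) (hR x (Finset.mem_range.1 hx)).2).trans
          (by linarith)
    _ = N * (N + 1) := by rw [Finset.sum_const, Finset.card_range, nsmul_eq_mul]

namespace DensitySystem

variable {N : ℕ} {M : ℝ} {R : ℕ → ℝ → ℝ}

theorem reflect (h : DensitySystem N M R) : DensitySystem N M (fun x => R (N + 1 - x)) where
  interior x hx t := by
    obtain ⟨y, rfl⟩ : ∃ y, N = x + y + 1 := ⟨N - x - 1, by omega⟩
    beta_reduce
    rw [show x + y + 1 + 1 - (x + 1) = y + 1 by omega, show x + y + 1 + 1 - (x + 2) = y by omega,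
      show x + y + 1 + 1 - x = y + 2 by omega, add_comm (R y t)]
    exact h.interior y (by omega) t
  left t := by simpa only [Nat.sub_zero, Nat.add_sub_cancel] using h.right t
  right t := by
    simpa only [Nat.sub_self, Nat.add_sub_cancel_left] using h.left t
  mem_Icc x t ht := h.mem_Icc _ t ht

theorem hasDerivAt_firstMoment_add (h : DensitySystem N M R) (hM : M ≠ 0) (t : ℝ) :
    HasDerivAt (fun t => firstMoment N R t + (N + 1) * M * R (N + 1) t)
      (1 / 2 * (R 0 t - R (N + 1) t)) t := by
  refine ((h.interior.hasDerivAt_firstMoment t).fun_add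
    ((h.right t).const_mul ((N + 1) * M))).congr_deriv ?_
  field_simp
  ring

/-- The total first moment, reservoir included, changes at rate at most `1 / 2`, while the weight of
the right reservoir in it is `(N + 1) M`. -/
theorem abs_right_sub_le (h : DensitySystem N M R) (hM : 0 < M) {s : ℝ} (hs : 0 ≤ s) :
    |R (N + 1) s - R (N + 1) 0| ≤ (N + s / (2 * (N + 1))) / M := by
  have hlip := Convex.norm_image_sub_le_of_norm_hasDerivWithin_le (C := 1 / 2)
    (fun t _ => (h.hasDerivAt_firstMoment_add hM.ne' t).hasDerivWithinAt) (fun t ht => by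
      have hleft := h.mem_Icc 0 t ht
      have hright := h.mem_Icc (N + 1) t ht
      rw [Real.norm_eq_abs, abs_le]
      constructor <;> linarith [hleft.1, hleft.2, hright.1, hright.2])
    (convex_Ici 0) (Set.mem_Ici.2 le_rfl) (Set.mem_Ici.2 hs)
  rw [sub_zero, Real.norm_eq_abs, Real.norm_eq_abs, abs_of_nonneg hs, abs_le] at hlip
  have hinitial := firstMoment_mem_Icc (N := N) (R := R) fun x _ => h.mem_Icc (x + 1) 0 le_rfl
  have hfinal := firstMoment_mem_Icc (N := N) (R := R) fun x _ => h.mem_Icc (x + 1) s hs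
  have hweight : 0 < (N + 1) * M := by positivity
  have hbound : (N + s / (2 * (N + 1))) / M = (N * (N + 1) + 1 / 2 * s) / ((N + 1) * M) := by
    field_simp
  rw [hbound, abs_le, ← neg_div, div_le_iff₀ hweight, le_div_iff₀ hweight]
  constructor <;> linarith [hlip.1, hlip.2, hinitial.1, hinitial.2, hfinal.1, hfinal.2]

theorem abs_left_sub_le (h : DensitySystem N M R) (hM : 0 < M) {s : ℝ} (hs : 0 ≤ s) :
    |R 0 s - R 0 0| ≤ (N + s / (2 * (N + 1))) / M := by
  simpa only [Nat.sub_self] using h.reflect.abs_right_sub_le hM hs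

theorem abs_sub_dirichletSolution_le (h : DensitySystem N M R) (hM : 0 < M) {a b ε s : ℝ}
    (ha : |R 0 0 - a| ≤ ε) (hb : |R (N + 1) 0 - b| ≤ ε) {x : ℕ} (hx : x ≤ N + 1) (hs : 0 ≤ s) :
    |R x s - dirichletSolution N a b (fun y => R y 0) x s|
      ≤ ε + (N + s / (2 * (N + 1))) / M := by
  have hε : 0 ≤ ε := (abs_nonneg _).trans ha
  have hmono : ∀ t ∈ Set.Icc 0 s, (N + t / (2 * (N + 1))) / M ≤ (N + s / (2 * (N + 1))) / M :=
    fun t ht => by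
    gcongr
    exact ht.2
  have hconst : IsDiscreteHeat N fun _ _ => ε + (N + s / (2 * (N + 1))) / M := by
    simpa only [zero_mul, zero_add] using
      IsDiscreteHeat.affine N 0 (ε + (N + s / (2 * (N + 1))) / M)
  refine h.interior.abs_sub_le (isDiscreteHeat_dirichletSolution N a b _) hconst
    (fun y hy => ?_) (fun t ht => ?_) (fun t ht => ?_) hx (Set.right_mem_Icc.2 hs)
  · rw [dirichletSolution_initial a b _ hy, sub_self, abs_zero]
    positivity
  · rw [dirichletSolution_left, add_comm ε]
    exact (abs_sub_le _ (R 0 0) a).trans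
      (add_le_add ((h.abs_left_sub_le hM ht.1).trans (hmono t ht)) ha)
  · rw [dirichletSolution_right, add_comm ε]
    exact (abs_sub_le _ (R (N + 1) 0) b).trans
      (add_le_add ((h.abs_right_sub_le hM ht.1).trans (hmono t ht)) hb)

end DensitySystem

/-! ### Scaling limits of the densities -/

section Limits

variable {M : ℕ → ℝ} {R : ℕ → ℕ → ℝ → ℝ} {s : ℕ → ℝ} {a b : ℝ}

theorem tendsto_natCast_div_capacity (hM : Tendsto (fun N : ℕ => M N / N) atTop atTop) :
    Tendsto (fun N : ℕ => (N : ℝ) / M N) atTop (𝓝 0) := by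
  simpa only [Function.comp_def, inv_div] using tendsto_inv_atTop_zero.comp hM

theorem tendsto_diffusive_time_div (hM : Tendsto (fun N : ℕ => M N / N) atTop atTop) (t : ℝ) :
    Tendsto (fun N : ℕ => (N : ℝ) ^ 2 * t / (N * M N)) atTop (𝓝 0) := by
  have hlim := (tendsto_natCast_div_capacity hM).mul_const t
  rw [zero_mul] at hlim
  refine hlim.congr' ?_
  filter_upwards [eventually_ne_atTop 0] with N hN
  rw [sq, mul_assoc, mul_div_mul_left _ _ (Nat.cast_ne_zero.2 hN), div_mul_eq_mul_div]

theorem eventually_capacity_pos (hM : Tendsto (fun N : ℕ => M N / N) atTop atTop) :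
    ∀ᶠ N in atTop, 0 < M N := by
  filter_upwards [hM.eventually_gt_atTop 0, eventually_gt_atTop 0] with N hMN hN
  exact (div_pos_iff_of_pos_right (Nat.cast_pos.2 hN)).1 hMN

theorem tendsto_reservoir_error (hM : Tendsto (fun N : ℕ => M N / N) atTop atTop)
    (hsM : Tendsto (fun N : ℕ => s N / (N * M N)) atTop (𝓝 0)) :
    Tendsto (fun N : ℕ => ((N : ℝ) + s N / (2 * (N + 1))) / M N) atTop (𝓝 0) := by
  have hlim := (tendsto_natCast_div_capacity hM).add
    ((tendsto_natCast_div_add_one.mul hsM).const_mul (1 / 2))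
  rw [mul_zero, mul_zero, add_zero] at hlim
  refine hlim.congr' ?_
  filter_upwards [eventually_ne_atTop 0, eventually_capacity_pos hM] with N hN hMN
  have hN' : (N : ℝ) ≠ 0 := Nat.cast_ne_zero.2 hN
  field_simp

theorem tendsto_left_reservoir (hR : ∀ᶠ N in atTop, DensitySystem N (M N) (R N))
    (hM : Tendsto (fun N : ℕ => M N / N) atTop atTop) (hs : ∀ N, 0 ≤ s N)
    (hsM : Tendsto (fun N : ℕ => s N / (N * M N)) atTop (𝓝 0))
    (ha : Tendsto (fun N => R N 0 0) atTop (𝓝 a)) :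
    Tendsto (fun N => R N 0 (s N)) atTop (𝓝 a) := by
  have hdiff : Tendsto (fun N => R N 0 (s N) - R N 0 0) atTop (𝓝 0) := by
    refine squeeze_zero_norm' ?_ (tendsto_reservoir_error hM hsM)
    filter_upwards [hR, eventually_capacity_pos hM] with N hRN hMN
    exact hRN.abs_left_sub_le hMN (hs N)
  simpa only [sub_add_cancel, zero_add] using hdiff.add ha

theorem tendsto_right_reservoir (hR : ∀ᶠ N in atTop, DensitySystem N (M N) (R N))
    (hM : Tendsto (fun N : ℕ => M N / N) atTop atTop) (hs : ∀ N, 0 ≤ s N)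
    (hsM : Tendsto (fun N : ℕ => s N / (N * M N)) atTop (𝓝 0))
    (hb : Tendsto (fun N => R N (N + 1) 0) atTop (𝓝 b)) :
    Tendsto (fun N => R N (N + 1) (s N)) atTop (𝓝 b) := by
  simpa only [Nat.sub_zero] using tendsto_left_reservoir (R := fun N x => R N (N + 1 - x))
    (hR.mono fun N hRN => hRN.reflect) hM hs hsM hb

theorem tendsto_sub_dirichletSolution (hR : ∀ᶠ N in atTop, DensitySystem N (M N) (R N))
    (hM : Tendsto (fun N : ℕ => M N / N) atTop atTop) (hs : ∀ N, 0 ≤ s N)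
    (hsM : Tendsto (fun N : ℕ => s N / (N * M N)) atTop (𝓝 0))
    (ha : Tendsto (fun N => R N 0 0) atTop (𝓝 a))
    (hb : Tendsto (fun N => R N (N + 1) 0) atTop (𝓝 b)) {x : ℕ → ℕ} (hx : ∀ N, x N ≤ N + 1) :
    Tendsto (fun N => R N (x N) (s N) - dirichletSolution N a b (fun y => R N y 0) (x N) (s N))
      atTop (𝓝 0) := by
  have herror := ((tendsto_iff_norm_sub_tendsto_zero.1 ha).add
    (tendsto_iff_norm_sub_tendsto_zero.1 hb)).add (tendsto_reservoir_error hM hsM)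
  rw [add_zero, add_zero] at herror
  refine squeeze_zero_norm' ?_ herror
  filter_upwards [hR, eventually_capacity_pos hM] with N hRN hMN
  exact hRN.abs_sub_dirichletSolution_le hMN (le_add_of_nonneg_right (norm_nonneg _))
    (le_add_of_nonneg_left (norm_nonneg (R N 0 0 - a))) (hx N) (hs N)

theorem eventually_abs_initial_le_one (hR : ∀ᶠ N in atTop, DensitySystem N (M N) (R N)) :
    ∀ᶠ N in atTop, ∀ y < N, |R N (y + 1) 0| ≤ 1 := by
  filter_upwards [hR] with N hRN y _
  have hmem := hRN.mem_Icc (y + 1) 0 le_rfl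
  exact abs_le.2 ⟨by linarith [hmem.1], hmem.2⟩

theorem tendsto_density_diffusive {u₀ : ℝ → ℝ} {r t : ℝ}
    (hR : ∀ᶠ N in atTop, DensitySystem N (M N) (R N))
    (hM : Tendsto (fun N : ℕ => M N / N) atTop atTop)
    (ha : Tendsto (fun N => R N 0 0) atTop (𝓝 a))
    (hb : Tendsto (fun N => R N (N + 1) 0) atTop (𝓝 b))
    (hinit : ∀ z ∈ Set.Ioo (0 : ℝ) 1,
      Tendsto (fun N : ℕ => R N (⌊(N : ℝ) * z⌋₊ + 1) 0) atTop (𝓝 (u₀ z)))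
    (hr : r ∈ Set.Icc (0 : ℝ) 1) (ht : 0 < t) :
    Tendsto (fun N : ℕ => R N ⌊(N : ℝ) * r⌋₊ ((N : ℝ) ^ 2 * t)) atTop
      (𝓝 (heatSolution u₀ a b r t)) := by
  have hdiff := tendsto_sub_dirichletSolution hR hM (fun N => by positivity)
    (tendsto_diffusive_time_div hM t) ha hb fun N => (floor_mul_le N hr.2).trans N.le_succ
  have hlim := hdiff.add
    (tendsto_dirichletSolution_diffusive (a := a) (b := b) (d := fun N y => R N y 0)
      (eventually_abs_initial_le_one hR) hinit hr.1 ht)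
  simpa only [sub_add_cancel, zero_add] using hlim

theorem tendsto_density_stationary {r : ℝ} (hR : ∀ᶠ N in atTop, DensitySystem N (M N) (R N))
    (hM : Tendsto (fun N : ℕ => M N / N) atTop atTop) (hs : ∀ N, 0 ≤ s N)
    (hs_top : Tendsto (fun N : ℕ => s N / (N : ℝ) ^ 2) atTop atTop)
    (hsM : Tendsto (fun N : ℕ => s N / (N * M N)) atTop (𝓝 0))
    (ha : Tendsto (fun N => R N 0 0) atTop (𝓝 a))
    (hb : Tendsto (fun N => R N (N + 1) 0) atTop (𝓝 b)) (hr : r ∈ Set.Icc (0 : ℝ) 1) :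
    Tendsto (fun N : ℕ => R N ⌊(N : ℝ) * r⌋₊ (s N)) atTop (𝓝 (stationaryProfile a b r)) := by
  have hdiff := tendsto_sub_dirichletSolution hR hM hs hsM ha hb
    fun N => (floor_mul_le N hr.2).trans N.le_succ
  have hlim := hdiff.add (tendsto_dirichletSolution_stationary (d := fun N y => R N y 0)
    (a := a) (b := b) (eventually_abs_initial_le_one hR) hs_top hr.1)
  simpa only [sub_add_cancel, zero_add] using hlim

end Limits

/-! ### Action of the generator on the occupation variables -/

section Generator

variable {N M : ℕ}

theorem eta_zero (w : State N M) : eta w 0 = (w.2.1 : ℝ) / M := if_pos rfl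

theorem eta_succ (w : State N M) {x : ℕ} (hx : x < N) : eta w (x + 1) = occ (w.1 ⟨x, hx⟩) := by
  rw [eta, if_neg x.succ_ne_zero, dif_pos (by simpa only [Nat.add_sub_cancel] using hx)]
  rfl

theorem eta_right (w : State N M) : eta w (N + 1) = (w.2.2 : ℝ) / M := by
  rw [eta, if_neg N.succ_ne_zero, dif_neg (by simp only [Nat.add_sub_cancel, lt_irrefl,
    not_false_eq_true])]

theorem occ_mem_Icc (b : Bool) : occ b ∈ Set.Icc (0 : ℝ) 1 := by
  cases b <;> simp [occ]

theorem fin_div_mem_Icc (n : Fin (M + 1)) : (n : ℝ) / M ∈ Set.Icc (0 : ℝ) 1 :=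
  ⟨by positivity, div_le_one_of_le₀ (by exact_mod_cast Nat.lt_succ_iff.1 n.2) M.cast_nonneg⟩

theorem eta_mem_Icc (w : State N M) (x : ℕ) : eta w x ∈ Set.Icc (0 : ℝ) 1 := by
  unfold eta
  split_ifs
  · exact fin_div_mem_Icc _
  · exact occ_mem_Icc _
  · exact fin_div_mem_Icc _

theorem boundaryRate_mul_reservoir (hM : M ≠ 0) (n : Fin (M + 1)) (b : Bool) :
    boundaryRate n b * ((reservoirUpdate n b : ℝ) / M - (n : ℝ) / M)
      = (occ b - (n : ℝ) / M) / (2 * M) := by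
  have hM' : (M : ℝ) ≠ 0 := Nat.cast_ne_zero.2 hM
  cases b
  · rcases Nat.eq_zero_or_pos n with hn | hn
    · simp [boundaryRate, reservoirUpdate, occ, hn]
    · simp only [boundaryRate, reservoirUpdate, occ, Bool.false_eq_true, if_false]
      rw [Nat.cast_sub hn]
      field_simp
      push_cast
      ring
  · rcases (Nat.lt_succ_iff.1 n.2).eq_or_lt with hn | hn
    · simp [boundaryRate, reservoirUpdate, occ, hn, hM']
    · simp only [boundaryRate, reservoirUpdate, occ, if_true]
      rw [min_eq_left (Nat.succ_le_of_lt hn)]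
      field_simp
      push_cast
      ring

theorem boundaryRate_mul_site (n : Fin (M + 1)) (b : Bool) :
    boundaryRate n b * (occ (!b) - occ b) = 1 / 2 * ((n : ℝ) / M - occ b) := by
  cases b <;> simp only [boundaryRate, occ, Bool.not_true, Bool.not_false, Bool.false_eq_true,
    if_true, if_false] <;> ring

theorem generator_apply (f : State N M → ℝ) (w : State N M) :
    generator N M f w =
      1 / 2 * (∑ i : Fin N, ∑ j : Fin N,
          if (i : ℕ) + 1 = j then f (exchange i j w) - f w else 0)
        + (∑ i : Fin N, if (i : ℕ) + 1 = N then
            boundaryRate w.2.2 (w.1 i) * (f (flipRight i w) - f w) else 0)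
        + (∑ i : Fin N, if (i : ℕ) = 0 then
            boundaryRate w.2.1 (w.1 i) * (f (flipLeft i w) - f w) else 0) := rfl

theorem sum_ite_val_eq {p : ℕ → Prop} [DecidablePred p] {k : ℕ} (hk : ∀ i, p i ↔ i = k)
    (F : Fin N → ℝ) :
    (∑ i : Fin N, if p i then F i else 0) = if h : k < N then F ⟨k, h⟩ else 0 := by
  simp only [hk]
  split_ifs with h
  · simp only [← Fin.ext_iff (b := ⟨k, h⟩), Finset.sum_ite_eq', Finset.mem_univ, if_true]
  · exact Finset.sum_eq_zero fun i _ => if_neg fun hi : (i : ℕ) = k => h (hi ▸ i.2)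

theorem generator_eta_zero (hN : 0 < N) (hM : M ≠ 0) :
    generator N M (eta · 0) = (2 * M : ℝ)⁻¹ • ((eta · 1) - (eta · 0)) := by
  funext w
  rw [generator_apply, sum_ite_val_eq (fun _ => Iff.rfl), dif_pos hN]
  simp only [eta_zero, exchange, flipRight, flipLeft, sub_self, ite_self, Finset.sum_const_zero,
    mul_zero, zero_add, Pi.smul_apply, Pi.sub_apply, smul_eq_mul]
  rw [boundaryRate_mul_reservoir hM, ← eta_succ w hN, div_eq_inv_mul]

theorem generator_eta_right (hN : 0 < N) (hM : M ≠ 0) :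
    generator N M (eta · (N + 1)) = (2 * M : ℝ)⁻¹ • ((eta · N) - (eta · (N + 1))) := by
  funext w
  obtain ⟨n, rfl⟩ : ∃ n, N = n + 1 := ⟨N - 1, by omega⟩
  rw [generator_apply, sum_ite_val_eq (k := n) (p := fun i => i + 1 = n + 1)
    (fun _ => Nat.add_right_cancel_iff), dif_pos n.lt_succ_self]
  simp only [eta_right, exchange, flipRight, flipLeft, sub_self, ite_self, Finset.sum_const_zero,
    mul_zero, zero_add, add_zero, Pi.smul_apply, Pi.sub_apply, smul_eq_mul]
  rw [boundaryRate_mul_reservoir hM, ← eta_succ w n.lt_succ_self, div_eq_inv_mul]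

theorem apply_swap_sub {ι : Type*} [DecidableEq ι] (f : ι → ℝ) {i j : ι} (hij : i ≠ j) (k : ι) :
    f (Equiv.swap i j k) - f k
      = (if i = k then f j - f k else 0) + (if j = k then f i - f k else 0) := by
  rcases eq_or_ne i k with rfl | hik
  · rw [Equiv.swap_apply_left, if_pos rfl, if_neg hij.symm, add_zero]
  rcases eq_or_ne j k with rfl | hjk
  · rw [Equiv.swap_apply_right, if_pos rfl, if_neg hij, zero_add]
  · rw [Equiv.swap_apply_of_ne_of_ne hik.symm hjk.symm, if_neg hik, if_neg hjk, sub_self, add_zero]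

theorem sum_swap_sub (g : ℕ → ℝ) (k : Fin N) :
    (∑ i : Fin N, ∑ j : Fin N, if (i : ℕ) + 1 = j then g (Equiv.swap i j k) - g k else 0)
      = (if (k : ℕ) + 1 < N then g (k + 1) - g k else 0)
        + (if 0 < (k : ℕ) then g (k - 1) - g k else 0) := by
  have hsplit : ∀ i j : Fin N,
      (if (i : ℕ) + 1 = j then g (Equiv.swap i j k) - g k else 0)
        = (if i = k then (if (i : ℕ) + 1 = j then g j - g k else 0) else 0)
          + (if j = k then (if (i : ℕ) + 1 = j then g i - g k else 0) else 0) := fun i j => by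
    by_cases hij : (i : ℕ) + 1 = j
    · simp only [if_pos hij]
      exact apply_swap_sub (fun y : Fin N => g y) (by rintro rfl; omega) k
    · simp only [if_neg hij, ite_self, add_zero]
  simp only [hsplit, Finset.sum_add_distrib]
  congr 1
  · rw [Finset.sum_comm]
    simp only [Finset.sum_ite_eq', Finset.mem_univ, if_true]
    exact sum_ite_val_eq (p := fun j => (k : ℕ) + 1 = j) (fun _ => eq_comm)
      (fun j : Fin N => g j - g k)
  · simp only [Finset.sum_ite_eq', Finset.mem_univ, if_true]
    split_ifs with hk
    · rw [sum_ite_val_eq (p := fun i => i + 1 = (k : ℕ)) (k := k - 1) (fun i => by omega)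
        (fun i : Fin N => g i - g k), dif_pos (by omega)]
    · exact Finset.sum_eq_zero fun i _ => if_neg (by omega)

theorem sum_exchange_eta_succ {x : ℕ} (hx : x < N) (w : State N M) :
    (∑ i : Fin N, ∑ j : Fin N,
        if (i : ℕ) + 1 = j then eta (exchange i j w) (x + 1) - eta w (x + 1) else 0)
      = (if x + 1 < N then eta w (x + 2) - eta w (x + 1) else 0)
        + (if 0 < x then eta w x - eta w (x + 1) else 0) := by
  have hswap : ∀ i j : Fin N,
      eta (exchange i j w) (x + 1) = eta w (Equiv.swap i j ⟨x, hx⟩ + 1) := fun i j => by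
    rw [eta_succ _ hx, eta_succ w (Equiv.swap i j ⟨x, hx⟩).2]
    rfl
  simp only [hswap]
  rw [sum_swap_sub (fun y => eta w (y + 1)) ⟨x, hx⟩]
  congr 1
  exact if_ctx_congr Iff.rfl (fun hx0 => by rw [Nat.sub_add_cancel hx0]) fun _ => rfl

theorem sum_flipRight_eta_succ {x : ℕ} (hx : x < N) (w : State N M) :
    (∑ i : Fin N, if (i : ℕ) + 1 = N then
        boundaryRate w.2.2 (w.1 i) * (eta (flipRight i w) (x + 1) - eta w (x + 1)) else 0)
      = if x + 1 = N then 1 / 2 * (eta w (N + 1) - eta w (x + 1)) else 0 := by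
  simp only [eta_succ _ hx, eta_right, flipRight]
  rw [Finset.sum_eq_single ⟨x, hx⟩]
  · rw [Function.update_self, boundaryRate_mul_site]
  · intro i _ hi
    rw [Function.update_of_ne hi.symm, sub_self, mul_zero, ite_self]
  · exact fun h => (h (Finset.mem_univ _)).elim

theorem sum_flipLeft_eta_succ {x : ℕ} (hx : x < N) (w : State N M) :
    (∑ i : Fin N, if (i : ℕ) = 0 then
        boundaryRate w.2.1 (w.1 i) * (eta (flipLeft i w) (x + 1) - eta w (x + 1)) else 0)
      = if x = 0 then 1 / 2 * (eta w 0 - eta w (x + 1)) else 0 := by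
  simp only [eta_succ _ hx, eta_zero, flipLeft]
  rw [Finset.sum_eq_single ⟨x, hx⟩]
  · rw [Function.update_self, boundaryRate_mul_site]
  · intro i _ hi
    rw [Function.update_of_ne hi.symm, sub_self, mul_zero, ite_self]
  · exact fun h => (h (Finset.mem_univ _)).elim

theorem generator_eta_succ {x : ℕ} (hx : x < N) :
    generator N M (eta · (x + 1))
      = (1 / 2 : ℝ) • ((eta · (x + 2)) + (eta · x) - (2 : ℝ) • (eta · (x + 1))) := by
  funext w
  rw [generator_apply, sum_exchange_eta_succ hx, sum_flipRight_eta_succ hx,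
    sum_flipLeft_eta_succ hx]
  simp only [Pi.smul_apply, Pi.sub_apply, Pi.add_apply, smul_eq_mul]
  have hright : (if x + 1 < N then eta w (x + 2) - eta w (x + 1) else 0)
      + 2 * (if x + 1 = N then 1 / 2 * (eta w (N + 1) - eta w (x + 1)) else 0)
        = eta w (x + 2) - eta w (x + 1) := by
    rcases (Nat.succ_le_of_lt hx).eq_or_lt with rfl | hxN
    · rw [if_neg (lt_irrefl _), if_pos rfl]
      ring
    · rw [if_pos hxN, if_neg hxN.ne]
      ring
  have hleft : (if 0 < x then eta w x - eta w (x + 1) else 0)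
      + 2 * (if x = 0 then 1 / 2 * (eta w 0 - eta w (x + 1)) else 0)
        = eta w x - eta w (x + 1) := by
    rcases x.eq_zero_or_pos with rfl | hx0
    · rw [if_neg (lt_irrefl _), if_pos rfl]
      ring
    · rw [if_pos hx0, if_neg hx0.ne']
      ring
  linarith

end Generator

/-! ### Expectations under a Markov process -/

section Markov

variable {S Ω : Type*} [MeasurableSpace S] [MeasurableSpace Ω] {P : Measure Ω}

theorem integrable_comp_of_finite [Finite S] [MeasurableSingletonClass S] [IsFiniteMeasure P]
    {Y : Ω → S} (hY : Measurable Y) (f : S → ℝ) : Integrable (fun ω => f (Y ω)) P := by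
  obtain ⟨C, hC⟩ := (Set.finite_range fun s => ‖f s‖).bddAbove
  exact Integrable.of_bound ((measurable_of_finite f).comp hY).aestronglyMeasurable C
    (Eventually.of_forall fun ω => hC ⟨Y ω, rfl⟩)

variable [Fintype S]

theorem IsMarkovProcess.integral_eq [IsFiniteMeasure P] {L : (S → ℝ) →ₗ[ℝ] (S → ℝ)}
    {X : ℝ≥0 → Ω → S} (hX : IsMarkovProcess L P X) (t : ℝ≥0) (f : S → ℝ) :
    ∫ ω, f (X t ω) ∂P = ∫ ω, semigroup L t f (X 0 ω) ∂P := by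
  have hle : (⨆ u : Set.Iic (0 : ℝ≥0), MeasurableSpace.comap (X u) inferInstance)
      ≤ (inferInstance : MeasurableSpace Ω) :=
    iSup_le fun u => (hX.measurable u).comap_le
  have hmarkov := hX.markov 0 t f
  rw [zero_add] at hmarkov
  rw [← integral_condExp hle]
  exact integral_congr_ae hmarkov

variable [MeasurableSingletonClass S] [IsFiniteMeasure P]

/-- The law of `Y` as the linear functional `f ↦ E[f(Y)]`. -/
noncomputable def expectation {Y : Ω → S} (hY : Measurable Y) (P : Measure Ω) [IsFiniteMeasure P] :
    (S → ℝ) →L[ℝ] ℝ :=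
  LinearMap.toContinuousLinearMap
    { toFun := fun f => ∫ ω, f (Y ω) ∂P
      map_add' := fun f g =>
        integral_add (integrable_comp_of_finite hY f) (integrable_comp_of_finite hY g)
      map_smul' := fun c _ => integral_const_mul c _ }

/-- The functional `f ↦ E[(exp (t L) f)(Y)]`, which for the initial state `Y` of a Markov process
with generator `L` is the expectation of `f` at time `t`. It makes sense for all real `t`. -/
noncomputable def semigroupExpectation (L : (S → ℝ) →ₗ[ℝ] (S → ℝ)) {Y : Ω → S}
    (hY : Measurable Y) (P : Measure Ω) [IsFiniteMeasure P] (t : ℝ) : (S → ℝ) →L[ℝ] ℝ :=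
  expectation hY P ∘L NormedSpace.exp (t • LinearMap.toContinuousLinearMap L)

theorem hasDerivAt_semigroupExpectation (L : (S → ℝ) →ₗ[ℝ] (S → ℝ)) {Y : Ω → S}
    (hY : Measurable Y) (f : S → ℝ) (t : ℝ) :
    HasDerivAt (fun t => semigroupExpectation L hY P t f)
      (semigroupExpectation L hY P t (L f)) t := by
  have hexp := (hasDerivAt_exp_smul_const (𝕂 := ℝ) (LinearMap.toContinuousLinearMap L) t).clm_apply
    (hasDerivAt_const t f)
  rw [map_zero, add_zero] at hexp
  exact (expectation hY P).hasFDerivAt.comp_hasDerivAt t hexp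

theorem IsMarkovProcess.semigroupExpectation_eq {L : (S → ℝ) →ₗ[ℝ] (S → ℝ)} {X : ℝ≥0 → Ω → S}
    (hX : IsMarkovProcess L P X) (t : ℝ≥0) (f : S → ℝ) :
    semigroupExpectation L (hX.measurable 0) P t f = ∫ ω, f (X t ω) ∂P :=
  (hX.integral_eq t f).symm

end Markov

/-! ### The densities of the particle system -/

section Density

variable {N M : ℕ} {Ω : Type*} [MeasurableSpace Ω] {P : Measure Ω} [IsProbabilityMeasure P]

theorem rho_mem_Icc {X : ℝ≥0 → Ω → State N M} {t : ℝ≥0} (hX : Measurable (X t)) (x : ℕ) :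
    rho P X x t ∈ Set.Icc (0 : ℝ) 1 :=
  (convex_Icc 0 1).integral_mem isClosed_Icc (Eventually.of_forall fun ω => eta_mem_Icc (X t ω) x)
    (integrable_comp_of_finite hX (eta · x))

theorem IsMarkovProcess.exists_densitySystem (hN : 0 < N) (hM : M ≠ 0)
    {X : ℝ≥0 → Ω → State N M} (hX : IsMarkovProcess (generator N M) P X) :
    ∃ R : ℕ → ℝ → ℝ, DensitySystem N M R ∧ ∀ x (t : ℝ≥0), R x t = rho P X x t := by
  have hrho : ∀ x (t : ℝ≥0), semigroupExpectation (generator N M) (hX.measurable 0) P t (eta · x)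
      = rho P X x t := fun x t => hX.semigroupExpectation_eq t _
  have hderiv := fun x => hasDerivAt_semigroupExpectation (P := P) (generator N M)
    (hX.measurable 0) (eta · x)
  refine ⟨fun x t => semigroupExpectation (generator N M) (hX.measurable 0) P t (eta · x),
    { interior := fun x hx t => (hderiv (x + 1) t).congr_deriv ?_
      left := fun t => (hderiv 0 t).congr_deriv ?_
      right := fun t => (hderiv (N + 1) t).congr_deriv ?_
      mem_Icc := fun x t ht => ?_ }, hrho⟩
  · rw [generator_eta_succ hx]
    simp only [map_smul, map_add, map_sub, smul_eq_mul]
  · rw [generator_eta_zero hN hM, map_smul, map_sub, smul_eq_mul, div_eq_inv_mul]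
  · rw [generator_eta_right hN hM, map_smul, map_sub, smul_eq_mul, div_eq_inv_mul]
  · lift t to ℝ≥0 using ht
    exact (hrho x t).symm ▸ rho_mem_Icc (hX.measurable t) x

theorem abs_integral_sub_le {Y : Ω → ℝ} (hY : Measurable Y) {C v δ : ℝ} (hYC : ∀ ω, |Y ω| ≤ C)
    (hδ : 0 ≤ δ) : |∫ ω, Y ω ∂P - v| ≤ δ + P.real {ω | δ ≤ |Y ω - v|} * (C + |v|) := by
  have hset : MeasurableSet {ω | δ ≤ |Y ω - v|} :=
    measurableSet_le measurable_const (hY.sub_const v).abs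
  have hint : Integrable Y P := Integrable.of_bound hY.aestronglyMeasurable C
    (Eventually.of_forall hYC)
  have hind : Integrable ({ω | δ ≤ |Y ω - v|}.indicator fun _ => C + |v|) P :=
    (integrable_const _).indicator hset
  calc |∫ ω, Y ω ∂P - v| = |∫ ω, (Y ω - v) ∂P| := by
        rw [integral_sub hint (integrable_const v), integral_const, probReal_univ, one_smul]
    _ ≤ ∫ ω, |Y ω - v| ∂P := abs_integral_le_integral_abs
    _ ≤ ∫ ω, (δ + {ω | δ ≤ |Y ω - v|}.indicator (fun _ => C + |v|) ω) ∂P := by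
        refine integral_mono (hint.sub (integrable_const v)).abs ((integrable_const δ).add hind)
          fun ω => ?_
        by_cases hω : δ ≤ |Y ω - v|
        · rw [Set.indicator_of_mem (show ω ∈ {ω | δ ≤ |Y ω - v|} from hω)]
          linarith [abs_sub (Y ω) v, hYC ω]
        · rw [Set.indicator_of_notMem (show ω ∉ {ω | δ ≤ |Y ω - v|} from hω), add_zero]
          exact (not_le.1 hω).le
    _ = δ + P.real {ω | δ ≤ |Y ω - v|} * (C + |v|) := by
        rw [integral_add (integrable_const δ) hind, integral_indicator_const _ hset,
          integral_const, probReal_univ, one_smul, smul_eq_mul]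

theorem tendsto_integral_of_tendsto_in_probability {Ω : ℕ → Type*} [∀ N, MeasurableSpace (Ω N)]
    {P : ∀ N, Measure (Ω N)} [∀ N, IsProbabilityMeasure (P N)] {Y : ∀ N, Ω N → ℝ} {C v : ℝ}
    (hY : ∀ᶠ N in atTop, Measurable (Y N)) (hYC : ∀ᶠ N in atTop, ∀ ω, |Y N ω| ≤ C)
    (hprob : ∀ δ > 0, Tendsto (fun N => P N {ω | δ ≤ |Y N ω - v|}) atTop (𝓝 0)) :
    Tendsto (fun N => ∫ ω, Y N ω ∂P N) atTop (𝓝 v) := by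
  refine Metric.tendsto_nhds.2 fun ε hε => ?_
  have hbad : Tendsto (fun N => (P N).real {ω | ε / 2 ≤ |Y N ω - v|} * (C + |v|)) atTop (𝓝 0) := by
    have hreal := (ENNReal.tendsto_toReal ENNReal.zero_ne_top).comp (hprob (ε / 2) (half_pos hε))
    simpa only [ENNReal.toReal_zero, zero_mul, Function.comp_def, Measure.real] using
      hreal.mul_const (C + |v|)
  filter_upwards [hY, hYC, hbad.eventually_lt_const (half_pos hε)] with N hYN hYCN hlt
  rw [Real.dist_eq]
  linarith [abs_integral_sub_le (P := P N) (v := v) hYN hYCN (half_pos hε).le]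

end Density

section InitialLaw

variable {M : ℕ → ℕ} {Ω : ℕ → Type*} [∀ N, MeasurableSpace (Ω N)] {P : ∀ N, Measure (Ω N)}
  [∀ N, IsProbabilityMeasure (P N)] {X : ∀ N, ℝ≥0 → Ω N → State N (M N)}

theorem exists_seq_densitySystem (hM : Tendsto (fun N => (M N : ℝ) / N) atTop atTop)
    (hX : ∀ᶠ N in atTop, IsMarkovProcess (generator N (M N)) (P N) (X N)) :
    ∃ R : ℕ → ℕ → ℝ → ℝ, ∀ᶠ N in atTop,
      DensitySystem N (M N) (R N) ∧ ∀ x (t : ℝ≥0), R N x t = rho (P N) (X N) x t := by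
  have hexists : ∀ᶠ N in atTop, ∃ R : ℕ → ℝ → ℝ,
      DensitySystem N (M N) R ∧ ∀ x (t : ℝ≥0), R x t = rho (P N) (X N) x t := by
    filter_upwards [hX, eventually_gt_atTop 0, eventually_capacity_pos hM] with N hXN hN hMN
    exact hXN.exists_densitySystem hN (Nat.cast_pos.1 hMN).ne'
  exact hexists.choice

theorem tendsto_rho_of_tendsto_in_probability {x : ℕ → ℕ} {t : ℝ≥0} {v : ℝ}
    (hX : ∀ᶠ N in atTop, Measurable (X N t))
    (hv : ∀ δ > 0, Tendsto (fun N => P N {ω | δ ≤ |eta (X N t ω) (x N) - v|}) atTop (𝓝 0)) :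
    Tendsto (fun N => rho (P N) (X N) (x N) t) atTop (𝓝 v) :=
  tendsto_integral_of_tendsto_in_probability
    (hX.mono fun N hXN => (measurable_of_finite fun w => eta w (x N)).comp hXN)
    (Eventually.of_forall fun N ω => by
      have hmem := eta_mem_Icc (X N t ω) (x N)
      exact abs_le.2 ⟨neg_one_lt_zero.le.trans hmem.1, hmem.2⟩) hv

end InitialLaw

/-! ### Time scales and the size of the reservoirs -/

theorem tendsto_reservoirSize_div_rpow {α : ℝ} (hα : -1 < α) :
    Tendsto (fun N : ℕ => (reservoirSize α N : ℝ) / (N : ℝ) ^ (1 + α)) atTop (𝓝 1) :=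
  (tendsto_nat_floor_div_atTop (R := ℝ)).comp
    ((tendsto_rpow_atTop (by linarith)).comp tendsto_natCast_atTop_atTop)

theorem tendsto_reservoirSize_div {α : ℝ} (hα : 0 < α) :
    Tendsto (fun N : ℕ => (reservoirSize α N : ℝ) / N) atTop atTop := by
  have hpow : Tendsto (fun N : ℕ => (N : ℝ) ^ α) atTop atTop :=
    (tendsto_rpow_atTop hα).comp tendsto_natCast_atTop_atTop
  refine ((tendsto_reservoirSize_div_rpow (by linarith)).pos_mul_atTop zero_lt_one hpow).congr' ?_
  filter_upwards [eventually_gt_atTop 0] with N hN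
  have hN' : (0 : ℝ) < N := Nat.cast_pos.2 hN
  rw [Real.rpow_add hN', Real.rpow_one, div_mul_eq_div_div, div_mul_cancel₀ _ (by positivity)]

theorem tendsto_rpow_time_div_reservoirSize {α β : ℝ} (hα : -1 < α) (hβ : β < α) (t : ℝ) :
    Tendsto (fun N : ℕ => (N : ℝ) ^ (2 + β) * t / (N * reservoirSize α N)) atTop (𝓝 0) := by
  have hpow : Tendsto (fun N : ℕ => (N : ℝ) ^ (-(α - β))) atTop (𝓝 0) :=
    (tendsto_rpow_neg_atTop (sub_pos.2 hβ)).comp tendsto_natCast_atTop_atTop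
  have hlim := (hpow.mul_const t).div (tendsto_reservoirSize_div_rpow hα) one_ne_zero
  rw [zero_mul, zero_div] at hlim
  refine hlim.congr' ?_
  filter_upwards [eventually_gt_atTop 0] with N hN
  have hN' : (0 : ℝ) < N := Nat.cast_pos.2 hN
  have hsplit : (N : ℝ) ^ (2 + β) = N * ((N : ℝ) ^ (-(α - β)) * (N : ℝ) ^ (1 + α)) := by
    rw [show 2 + β = 1 + (-(α - β) + (1 + α)) by ring, Real.rpow_add hN', Real.rpow_add hN',
      Real.rpow_one]
  rw [Pi.div_apply, hsplit, div_div_eq_mul_div, mul_assoc (N : ℝ), mul_div_mul_left _ _ hN'.ne',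
    mul_right_comm]

theorem tendsto_rpow_time_div_sq {β t : ℝ} (hβ : 0 < β) (ht : 0 < t) :
    Tendsto (fun N : ℕ => (N : ℝ) ^ (2 + β) * t / (N : ℝ) ^ 2) atTop atTop := by
  refine (((tendsto_rpow_atTop hβ).comp tendsto_natCast_atTop_atTop).atTop_mul_const ht).congr' ?_
  filter_upwards [eventually_gt_atTop 0] with N hN
  have hN' : (0 : ℝ) < N := Nat.cast_pos.2 hN
  rw [Function.comp_apply, Real.rpow_add hN', Real.rpow_two, mul_assoc,
    mul_div_cancel_left₀ _ (by positivity)]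

theorem tendsto_profile_floor {u₀ : ℝ → ℝ} (hu₀ : ContinuousOn u₀ (Set.Ioo 0 1)) {z : ℝ}
    (hz : z ∈ Set.Ioo (0 : ℝ) 1) :
    Tendsto (fun N : ℕ => u₀ ((⌊(N : ℝ) * z⌋₊ + 1 : ℕ) / N)) atTop (𝓝 (u₀ z)) := by
  simpa only [Function.comp_def, Nat.cast_add_one] using
    (hu₀.continuousAt (Ioo_mem_nhds hz.1 hz.2)).tendsto.comp (tendsto_floor_add_one_div hz.1.le)

end Channel

theorem mainTheorem2_general
    {M : ℕ → ℕ} (hM : Tendsto (fun N => (M N : ℝ) / N) atTop atTop)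
    {u₀ : ℝ → ℝ} (hu₀ : ContinuousOn u₀ (Set.Ioo 0 1)) {vMinus vPlus : ℝ}
    {Ω : ℕ → Type*} [∀ N, MeasurableSpace (Ω N)]
    {P : ∀ N, Measure (Ω N)} [∀ N, IsProbabilityMeasure (P N)]
    {X : ∀ N, ℝ≥0 → Ω N → Channel.State N (M N)}
    (hX : ∀ᶠ N in atTop, Channel.IsMarkovProcess (Channel.generator N (M N)) (P N) (X N))
    (hInitMinus : ∀ δ > 0,
      Tendsto (fun N => P N {ω | δ ≤ |((X N 0 ω).2.1 : ℝ) / M N - vMinus|}) atTop (𝓝 0))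
    (hInitPlus : ∀ δ > 0,
      Tendsto (fun N => P N {ω | δ ≤ |((X N 0 ω).2.2 : ℝ) / M N - vPlus|}) atTop (𝓝 0))
    (hInit : ∀ z ∈ Set.Ioo (0 : ℝ) 1,
      Tendsto (fun N : ℕ => Channel.rho (P N) (X N) (⌊(N : ℝ) * z⌋₊ + 1) 0) atTop (𝓝 (u₀ z))) :
    (∃ u : ℝ → ℝ → ℝ, Channel.IsHeatSolution u₀ vMinus vPlus u ∧
      (∀ w : ℝ → ℝ → ℝ, Channel.IsHeatSolution u₀ vMinus vPlus w →
        ∀ r ∈ Set.Icc (0 : ℝ) 1, ∀ t > 0, w r t = u r t) ∧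
      ∀ r ∈ Set.Icc (0 : ℝ) 1, ∀ t : ℝ≥0, 0 < t →
        Tendsto (fun N : ℕ => Channel.rho (P N) (X N) ⌊(N : ℝ) * r⌋₊ ((N : ℝ≥0) ^ 2 * t))
          atTop (𝓝 (u r t))) ∧
    ∀ s : ℕ → ℝ≥0, Tendsto (fun N => (s N : ℝ) / (N * M N)) atTop (𝓝 0) →
      (Tendsto (fun N => Channel.rho (P N) (X N) 0 (s N)) atTop (𝓝 vMinus) ∧
        Tendsto (fun N => Channel.rho (P N) (X N) (N + 1) (s N)) atTop (𝓝 vPlus)) ∧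
      (Tendsto (fun N => (s N : ℝ) / (N : ℝ) ^ 2) atTop atTop → ∀ r ∈ Set.Icc (0 : ℝ) 1,
        Tendsto (fun N : ℕ => Channel.rho (P N) (X N) ⌊(N : ℝ) * r⌋₊ (s N))
          atTop (𝓝 ((vPlus - vMinus) * r + vMinus))) := by
  obtain ⟨R, hR⟩ := Channel.exists_seq_densitySystem hM hX
  have hsys := hR.mono fun N hRN => hRN.1
  have hrho : ∀ (x : ℕ → ℕ) (s : ℕ → ℝ≥0) {l : ℝ},
      Tendsto (fun N => Channel.rho (P N) (X N) (x N) (s N)) atTop (𝓝 l) ↔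
        Tendsto (fun N => R N (x N) (s N)) atTop (𝓝 l) := fun x s _ =>
    tendsto_congr' (hR.mono fun N hRN => (hRN.2 (x N) (s N)).symm)
  have hmeas := hX.mono fun N hXN => hXN.measurable 0
  have ha := (hrho (fun _ => 0) (fun _ => 0)).1
    (Channel.tendsto_rho_of_tendsto_in_probability hmeas
      (by simpa only [Channel.eta_zero] using hInitMinus))
  have hb := (hrho (fun N => N + 1) (fun _ => 0)).1
    (Channel.tendsto_rho_of_tendsto_in_probability hmeas
      (by simpa only [Channel.eta_right] using hInitPlus))
  have hu₀_le : ∀ z ∈ Set.Ioo (0 : ℝ) 1, |u₀ z| ≤ 1 := fun z hz =>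
    le_of_tendsto (hInit z hz).abs (hmeas.mono fun N hXN =>
      have hmem := Channel.rho_mem_Icc hXN _
      abs_le.2 ⟨neg_one_lt_zero.le.trans hmem.1, hmem.2⟩)
  have hsol := Channel.isHeatSolution_heatSolution hu₀ hu₀_le vMinus vPlus
  refine ⟨⟨_, hsol, fun w hw r hr t ht => hw.unique hsol hr ht, fun r hr t ht => ?_⟩,
    fun s hs => ⟨⟨?_, ?_⟩, fun hs_top r hr => ?_⟩⟩
  · rw [hrho _ fun N => (N : ℝ≥0) ^ 2 * t]
    exact Channel.tendsto_density_diffusive hsys hM ha hb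
      (fun z hz => (hrho _ fun _ => 0).1 (hInit z hz)) hr ht
  · exact (hrho (fun _ => 0) s).2
      (Channel.tendsto_left_reservoir hsys hM (fun N => (s N).2) hs ha)
  · exact (hrho (fun N => N + 1) s).2
      (Channel.tendsto_right_reservoir hsys hM (fun N => (s N).2) hs hb)
  · exact (hrho _ s).2
      (Channel.tendsto_density_stationary hsys hM (fun N => (s N).2) hs_top hs ha hb hr)

theorem mainTheorem2
    (α : ℝ) (hα : 0 < α)
    (u₀ : ℝ → ℝ) (hu₀ : ContinuousOn u₀ (Set.Ioo 0 1))
    (hu₀_mem : ∀ r ∈ Set.Ioo (0 : ℝ) 1, u₀ r ∈ Set.Icc (0 : ℝ) 1)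
    (vMinus vPlus : ℝ) (hvMinus : vMinus ∈ Set.Icc (0 : ℝ) 1) (hvPlus : vPlus ∈ Set.Icc (0 : ℝ) 1)
    -- for each `N ≥ 1`, the process with reservoirs of size `N ^ (1 + α)`
    (Ω : ℕ → Type*) [∀ N, MeasurableSpace (Ω N)]
    (P : ∀ N, Measure (Ω N)) [∀ N, IsProbabilityMeasure (P N)]
    (X : ∀ N, ℝ≥0 → Ω N → Channel.State N (Channel.reservoirSize α N))
    (hX : ∀ N, 1 ≤ N →
      Channel.IsMarkovProcess (Channel.generator N (Channel.reservoirSize α N)) (P N) (X N))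
    -- initial state: `n_±(0) / M → v_±` in probability and `ρ(x, 0) = u₀(x / N)` in the channel
    (hInitMinus : ∀ δ > 0, Tendsto
      (fun N => P N {ω | δ ≤ |((X N 0 ω).2.1 : ℝ) / Channel.reservoirSize α N - vMinus|})
      atTop (𝓝 0))
    (hInitPlus : ∀ δ > 0, Tendsto
      (fun N => P N {ω | δ ≤ |((X N 0 ω).2.2 : ℝ) / Channel.reservoirSize α N - vPlus|})
      atTop (𝓝 0))
    (hInit : ∀ N x : ℕ, 1 ≤ x → x ≤ N → Channel.rho (P N) (X N) x 0 = u₀ ((x : ℝ) / N)) :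
    -- a)
    ((∃ u : ℝ → ℝ → ℝ, Channel.IsHeatSolution u₀ vMinus vPlus u ∧
        (∀ w : ℝ → ℝ → ℝ, Channel.IsHeatSolution u₀ vMinus vPlus w →
          ∀ r ∈ Set.Icc (0 : ℝ) 1, ∀ t > 0, w r t = u r t) ∧
        ∀ r ∈ Set.Icc (0 : ℝ) 1, ∀ t : ℝ≥0, 0 < t →
          Tendsto (fun N : ℕ => Channel.rho (P N) (X N) ⌊(N : ℝ) * r⌋₊ ((N : ℝ≥0) ^ 2 * t))
            atTop (𝓝 (u r t))) ∧
      ∀ t : ℝ≥0, 0 < t →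
        Tendsto (fun N : ℕ => Channel.rho (P N) (X N) 0 ((N : ℝ≥0) ^ 2 * t))
          atTop (𝓝 vMinus) ∧
        Tendsto (fun N : ℕ => Channel.rho (P N) (X N) (N + 1) ((N : ℝ≥0) ^ 2 * t))
          atTop (𝓝 vPlus)) ∧
    -- b)
    (∀ α' : ℝ, 0 < α' → α' < α → ∀ t : ℝ≥0, 0 < t →
      (∀ r ∈ Set.Icc (0 : ℝ) 1,
        Tendsto (fun N : ℕ =>
            Channel.rho (P N) (X N) ⌊(N : ℝ) * r⌋₊ ((N : ℝ≥0) ^ (2 + α') * t))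
          atTop (𝓝 ((vPlus - vMinus) * r + vMinus))) ∧
      Tendsto (fun N : ℕ => Channel.rho (P N) (X N) 0 ((N : ℝ≥0) ^ (2 + α') * t))
        atTop (𝓝 vMinus) ∧
      Tendsto (fun N : ℕ => Channel.rho (P N) (X N) (N + 1) ((N : ℝ≥0) ^ (2 + α') * t))
        atTop (𝓝 vPlus)) := by
  have hM := Channel.tendsto_reservoirSize_div hα
  obtain ⟨hdiffusive, hscale⟩ := mainTheorem2_general hM hu₀
    ((eventually_ge_atTop 1).mono hX) hInitMinus hInitPlus fun z hz =>
      (Channel.tendsto_profile_floor hu₀ hz).congr' <| (eventually_gt_atTop 0).mono fun N hN =>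
        (hInit N _ (Nat.le_add_left 1 _) (Channel.floor_mul_lt hN hz)).symm
  refine ⟨⟨hdiffusive, fun t _ => (hscale (fun N => (N : ℝ≥0) ^ 2 * t) ?_).1⟩,
    fun α' hα' hα'α t ht => ?_⟩
  · exact Channel.tendsto_diffusive_time_div hM t
  · obtain ⟨hreservoirs, hprofile⟩ := hscale (fun N => (N : ℝ≥0) ^ (2 + α') * t)
      (Channel.tendsto_rpow_time_div_reservoirSize (by linarith) hα'α t)
    exact ⟨hprofile (Channel.tendsto_rpow_time_div_sq hα' ht), hreservoirs⟩
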